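/- Let $M$ be a connected smooth manifold of dimension $4n\ge 8$ and let $Q\subset\mathrm{End}(TM)$ be an almost quaternionic structure, i.e. a rank three subbundle locally generated by smooth almost complex structures $J_1,J_2,J_3$ with $J_1J_2=J_3=-J_2J_1$ (an admissible basis). Let $D$ be a quaternionic connection on $(M,Q)$, i.e. a torsion-free linear connection on $M$ which preserves $Q$, and assume that $D$ is self-dual: the curvature $R$ of the connection induced by $D$ on $\Lambda^{4n}(T^*M)$ satisfies $R_{JX,JY}=R_{X,Y}$ for every $J\in Q$ with $J^2=-\mathrm{Id}$. Let $\pi:Z\to M$ be the twistor space, $Z_p=\{J\in Q_p: J^2=-\mathrm{Id}\}$. It carries the complex structure $\mathcal J$ which, at $J\in Z_p$, acts as $J$ on the $D$-horizontal space (identified with $T_pM$ by $\pi_*$) and as $B\mapsto J\circ B$ on the vertical space $T_JZ_p=\{B\in Q_p: BJ=-JB\}$. Let $\Theta\to Z$ be the vertical tangent bundle, $\Theta_J=T_JZ_{\pi(J)}\subset Q_{\pi(J)}$, a complex line bundle with the fibrewise complex structure $B\mapsto J\circ B$, also denoted by $\mathcal J$; let $\Pi_J(B)=\frac12(B+J\circ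 B\circ J)$ be the projection of $Q_{\pi(J)}$ onto $\Theta_J$, and let $\nabla=\Pi\circ\pi^*D$ be the induced connection on $\Theta$. The operator $\bar\partial^D$ is the $(0,1)$-part of $\nabla$: $\bar\partial^D_Us=\frac12(\nabla_Us+\mathcal J\nabla_{\mathcal JU}s)$ for $U\in TZ$ and $s\in\Gamma(\Theta)$. A section $A\in\Gamma(Q)$ defines the distinguished section $\tilde A\in\Gamma(\Theta)$, $\tilde A(J)=\Pi_J(A)$. Let $H=\mathbb C^2$ be the standard representation of $Sp(1)=SU(2)$, with invariant symplectic form $\omega$ (by which $H\cong H^*$) and hermitian metric. Write locally $TM\otimes\mathbb C=\mathbf E\otimes\mathbf H$, where the elements of $Q$ act trivially on $\mathbf E$ and as $\mathfrak{sp}(1)\subset S^2(H)\subset\mathrm{End}(H)$ on $\mathbf H$, so that $Q\otimes\mathbb C=S^2(\mathbf H)$. Then $T^*M\otimes Q$ (complexified) is $\mathbf E^*\otimes\mathbf H\otimes S^2(\mathbf H)=\mathbf E^*\otimes S^3(\mathbf H)\oplus\mathbf E^*\otimes\mathbf H$, where $S^3(H)$ is the kernel of $F:H\otimes S^2(H)\to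 H$, $F(h,h_1h_2+h_2h_1)=\omega(h,h_1)h_2+\omega(h,h_2)h_1$, and the second summand corresponds to the hermitian orthogonal of $S^3(H)$ in $H\otimes S^2(H)$. The Penrose operator $P^D:\Gamma(Q)\to\Gamma(\mathbf E^*\otimes S^3(\mathbf H))$ is the composition of $D:\Gamma(Q)\to\Gamma(T^*M\otimes Q)$ with the projection onto the first summand. Then, for every $A\in\Gamma(Q)$, the distinguished section $\tilde A$ of $\Theta$ is $\bar\partial^D$-holomorphic (i.e. $\bar\partial^D\tilde A=0$) if and only if $P^DA=0$. -/

import Mathlib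

open Bundle Set FiberBundle
open scoped Manifold ContDiff Topology TensorProduct

noncomputable section

namespace QuatTwistor

/-! ## The induced connection on the endomorphism bundle -/

section Geometry

variable {E : Type*} [NormedAddCommGroup E] [NormedSpace ℝ E]
  {M : Type*} [TopologicalSpace M] [ChartedSpace E M]

variable (E) in
/-- The fibre `End(T_x M)` of the bundle `End(TM)`, with model fibre `E →L[ℝ] E`. -/
abbrev EndT (x : M) : Type _ := TangentSpace 𝓘(ℝ, E) x →L[ℝ] TangentSpace 𝓘(ℝ, E) x

variable (E M) in
/-- The total space of `End(TM)`, a smooth manifold modelled on `E × (E →L[ℝ] E)`. -/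
abbrev EndBundle : Type _ := TotalSpace (E →L[ℝ] E) (EndT E : M → Type _)

variable (E) in
/-- The model with corners of the total space of `End(TM)`. -/
abbrev endModel : ModelWithCorners ℝ (E × (E →L[ℝ] E)) (ModelProd E (E →L[ℝ] E)) :=
  𝓘(ℝ, E).prod 𝓘(ℝ, E →L[ℝ] E)

variable [IsManifold 𝓘(ℝ, E) ∞ M]

/-- A section of `End(TM)`, viewed as a map into the total space. -/
def secMap (A : Π x : M, EndT E x) (x : M) : EndBundle E M := ⟨x, A x⟩

/-- For a differentiable section `A` of `End(TM)`, the expression `D(A Y) - A (D Y)` is tensorial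
in the vector field `Y`. -/
theorem tensorialAt_endCov
    (D : CovariantDerivative 𝓘(ℝ, E) E (TangentSpace 𝓘(ℝ, E) : M → Type _))
    (A : Π x : M, EndT E x) (x : M)
    (hA : MDifferentiableAt 𝓘(ℝ, E) (endModel E) (secMap A) x) :
    TensorialAt 𝓘(ℝ, E) E
      (fun Y : Π x : M, TangentSpace 𝓘(ℝ, E) x ↦ D (fun y ↦ A y (Y y)) x - A x ∘L D Y x) x where
  smul := by
    intro f Y hf hY
    have hAY : MDiffAt (T% (fun y ↦ A y (Y y))) x := hA.clm_bundle_apply hY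
    have h1 : (fun y ↦ A y ((f • Y) y)) = f • (fun y ↦ A y (Y y)) := by
      funext y; simp
    rw [h1, D.isCovariantDerivativeOnUniv.leibniz hAY hf,
      D.isCovariantDerivativeOnUniv.leibniz hY hf]
    ext v
    simp
    module
  add := by
    intro Y Y' hY hY'
    have hAY : MDiffAt (T% (fun y ↦ A y (Y y))) x := hA.clm_bundle_apply hY
    have hAY' : MDiffAt (T% (fun y ↦ A y (Y' y))) x := hA.clm_bundle_apply hY'
    have h1 : (fun y ↦ A y ((Y + Y') y)) = (fun y ↦ A y (Y y)) + (fun y ↦ A y (Y' y)) := by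
      funext y; simp
    rw [h1, D.isCovariantDerivativeOnUniv.add hAY hAY',
      D.isCovariantDerivativeOnUniv.add hY hY']
    ext v
    simp
    abel

variable [FiniteDimensional ℝ E]

open Classical in
/-- The covariant derivative `D_X A` of a section `A` of `End(TM)` with respect to the connection
induced by `D`: `(D_X A) Y = D_X (A Y) - A (D_X Y)` (see `endCov_apply`); it is `0` where `A` is not
differentiable. As for Mathlib's covariant derivatives, `endCov D A x X` stands for `D_X A`. -/
def endCov (D : CovariantDerivative 𝓘(ℝ, E) E (TangentSpace 𝓘(ℝ, E) : M → Type _))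
    (A : Π x : M, EndT E x) (x : M) : TangentSpace 𝓘(ℝ, E) x →L[ℝ] EndT E x :=
  if hA : MDifferentiableAt 𝓘(ℝ, E) (endModel E) (secMap A) x then
    ContinuousLinearMap.flip (E := E) (F := E) (G := E)
      (TensorialAt.mkHom _ x (tensorialAt_endCov D A x hA))
  else 0

/-- The defining property of the induced connection on `End(TM)`. -/
theorem endCov_apply (D : CovariantDerivative 𝓘(ℝ, E) E (TangentSpace 𝓘(ℝ, E) : M → Type _))
    (A : Π x : M, EndT E x) (x : M)
    (hA : MDifferentiableAt 𝓘(ℝ, E) (endModel E) (secMap A) x)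
    (Y : Π x : M, TangentSpace 𝓘(ℝ, E) x) (hY : MDiffAt (T% Y) x)
    (X : TangentSpace 𝓘(ℝ, E) x) :
    endCov D A x X (Y x) = D (fun y ↦ A y (Y y)) x X - A x (D Y x X) := by
  have h : endCov D A x = ContinuousLinearMap.flip (E := E) (F := E) (G := E)
      (TensorialAt.mkHom _ x (tensorialAt_endCov D A x hA)) := dif_pos hA
  rw [h]
  exact congrArg (fun L ↦ L X) (TensorialAt.mkHom_apply (tensorialAt_endCov D A x hA) hY)

/-! ## Quaternionic structures and quaternionic connections -/

/-- `J 0, J 1, J 2` is an admissible basis of the subspace `Qx` of `End(T_x M)`: three complex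
structures that satisfy the quaternionic relations and generate `Qx`. -/
structure IsAdmissibleBasis {x : M} (Qx : Submodule ℝ (EndT E x)) (J : Fin 3 → EndT E x) :
    Prop where
  sq : ∀ i, J i ∘L J i = -ContinuousLinearMap.id ℝ (TangentSpace 𝓘(ℝ, E) x)
  mul_zero_one : J 0 ∘L J 1 = J 2
  mul_one_two : J 1 ∘L J 2 = J 0
  mul_two_zero : J 2 ∘L J 0 = J 1
  span_eq : Submodule.span ℝ (Set.range J) = Qx

/-- `Q` is an almost quaternionic structure: a subbundle of `End(TM)` which is locally generated by
three smooth almost complex structures that satisfy the quaternionic relations. -/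
def IsAlmostQuaternionic (Q : Π x : M, Submodule ℝ (EndT E x)) : Prop :=
  ∀ p : M, ∃ U : Set M, IsOpen U ∧ p ∈ U ∧ ∃ J : Fin 3 → Π x : M, EndT E x,
    (∀ i, ContMDiffOn 𝓘(ℝ, E) (endModel E) ∞ (secMap (J i)) U) ∧
      ∀ x ∈ U, IsAdmissibleBasis (Q x) (fun i ↦ J i x)

/-- `A` restricts to a smooth section of `Q` over `U`. -/
def IsSmoothSectionOn (Q : Π x : M, Submodule ℝ (EndT E x)) (A : Π x : M, EndT E x)
    (U : Set M) : Prop :=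
  ContMDiffOn 𝓘(ℝ, E) (endModel E) ∞ (secMap A) U ∧ ∀ x ∈ U, A x ∈ Q x

/-- `D` is a quaternionic connection on `(M, Q)`: a smooth torsion-free linear connection which
preserves `Q`, that is, which maps (local) sections of `Q` to `Q`-valued `1`-forms. -/
structure IsQuaternionicConnection (Q : Π x : M, Submodule ℝ (EndT E x))
    (D : CovariantDerivative 𝓘(ℝ, E) E (TangentSpace 𝓘(ℝ, E) : M → Type _)) : Prop where
  smooth : D.ContMDiffCovariantDerivative ∞
  torsion_eq_zero : D.torsion = 0
  preserves : ∀ (U : Set M) (A : Π x : M, EndT E x), IsOpen U → IsSmoothSectionOn Q A U →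
    ∀ x ∈ U, ∀ X : TangentSpace 𝓘(ℝ, E) x, endCov D A x X ∈ Q x

/-! ## Self-dual connections -/

variable (E M) in
/-- Vector fields on `M`. -/
abbrev VF : Type _ := Π x : M, TangentSpace 𝓘(ℝ, E) x

/-- Smooth vector fields. -/
def IsSmoothVF (X : VF E M) : Prop :=
  ContMDiff 𝓘(ℝ, E) 𝓘(ℝ, E).tangent ∞ (fun x ↦ (⟨x, X x⟩ : TangentBundle 𝓘(ℝ, E) M))

variable (E M) in
/-- Differential forms of degree `k` on `M`, not assumed to be smooth. -/
abbrev Form (k : ℕ) : Type _ := Π x : M, (TangentSpace 𝓘(ℝ, E) x) [⋀^Fin k]→ₗ[ℝ] ℝ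

/-- The function `η(Y₁, …, Y_k)`, for a `k`-form `η` and vector fields `Y₁, …, Y_k`. -/
def Form.eval {k : ℕ} (η : Form E M k) (Y : Fin k → VF E M) (x : M) : ℝ := η x (fun i ↦ Y i x)

/-- A `k`-form is smooth if it takes smooth values on smooth vector fields. -/
def Form.IsSmooth {k : ℕ} (η : Form E M k) : Prop :=
  ∀ Y : Fin k → VF E M, (∀ i, IsSmoothVF (Y i)) →
    ContMDiff 𝓘(ℝ, E) 𝓘(ℝ, ℝ) ∞ (η.eval Y)

/-- The covariant derivative `D_X` on covariant tensors of degree `k`, the latter being considered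
as functions of `k` vector fields:
`(D_X Φ)(Y₁, …, Y_k) = X (Φ (Y₁, …, Y_k)) - ∑ i, Φ (Y₁, …, D_X Y_i, …, Y_k)`. -/
def tensorCov (D : CovariantDerivative 𝓘(ℝ, E) E (TangentSpace 𝓘(ℝ, E) : M → Type _)) {k : ℕ}
    (X : VF E M) (Φ : (Fin k → VF E M) → M → ℝ) : (Fin k → VF E M) → M → ℝ :=
  fun Y x ↦ mvfderiv 𝓘(ℝ, E) (Φ Y) x (X x)
    - ∑ i, Φ (Function.update Y i (fun y ↦ D (Y i) y (X y))) x

/-- The curvature `R_{X,Y} η = D_X D_Y η - D_Y D_X η - D_{[X,Y]} η` of the connection induced by `D`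
on the bundle of `k`-forms. -/
def formCurvature (D : CovariantDerivative 𝓘(ℝ, E) E (TangentSpace 𝓘(ℝ, E) : M → Type _)) {k : ℕ}
    (X Y : VF E M) (η : Form E M k) (W : Fin k → VF E M) (x : M) : ℝ :=
  tensorCov D X (tensorCov D Y η.eval) W x - tensorCov D Y (tensorCov D X η.eval) W x
    - tensorCov D (VectorField.mlieBracket 𝓘(ℝ, E) X Y) η.eval W x

/-- `D` is self-dual: the curvature of the connection induced by `D` on the bundle `Λ^{top}(T^*M)`
is `Q`-hermitian, i.e. `R_{JX,JY} = R_{X,Y}` for every complex structure `J` which belongs to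
`Q`. -/
def IsSelfDual (Q : Π x : M, Submodule ℝ (EndT E x))
    (D : CovariantDerivative 𝓘(ℝ, E) E (TangentSpace 𝓘(ℝ, E) : M → Type _)) : Prop :=
  ∀ (η : Form E M (Module.finrank ℝ E)), η.IsSmooth →
  ∀ (W : Fin (Module.finrank ℝ E) → VF E M), (∀ i, IsSmoothVF (W i)) →
  ∀ X Y X' Y' : VF E M, IsSmoothVF X → IsSmoothVF Y → IsSmoothVF X' → IsSmoothVF Y' →
  ∀ (p : M), ∀ J ∈ Q p, J ∘L J = -ContinuousLinearMap.id ℝ (TangentSpace 𝓘(ℝ, E) p) →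
    X' p = J (X p) → Y' p = J (Y p) →
    formCurvature D X' Y' η W p = formCurvature D X Y η W p

/-! ## The twistor space -/

/-- The twistor space `Z` of `(M, Q)`, as a subset of the total space of `End(TM)`: the set of
complex structures of the tangent spaces of `M` which belong to `Q`. -/
def twistorSpace (Q : Π x : M, Submodule ℝ (EndT E x)) : Set (EndBundle E M) :=
  {z | z.2 ∈ Q z.proj ∧
    z.2 ∘L z.2 = -ContinuousLinearMap.id ℝ (TangentSpace 𝓘(ℝ, E) z.proj)}

/-- The tangent space `T_z Z` of the twistor space, as a subset of the tangent space at `z` of the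
total space of `End(TM)`: the velocities at `0` of smooth curves in `Z` that start at `z`. -/
def twistorTangent (Q : Π x : M, Submodule ℝ (EndT E x)) (z : EndBundle E M) :
    Set (TangentSpace (endModel E) z) :=
  {U | ∃ c : ℝ → EndBundle E M, ContMDiffAt 𝓘(ℝ, ℝ) (endModel E) ∞ c 0 ∧
    (∀ᶠ t in 𝓝 (0 : ℝ), c t ∈ twistorSpace Q) ∧ c 0 = z ∧
    (mfderiv 𝓘(ℝ, ℝ) (endModel E) c 0 (1 : ℝ) : E × (E →L[ℝ] E)) = U}

/-- The differential `π_* : T_z Z → T_p M` of the bundle projection. -/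
def projDeriv (z : EndBundle E M) (U : TangentSpace (endModel E) z) :
    TangentSpace 𝓘(ℝ, E) z.proj :=
  mfderiv (endModel E) 𝓘(ℝ, E) (TotalSpace.proj : EndBundle E M → M) z U

/-- The pull-back `π^*D` of the connection `D` of `End(TM)` to a subset `S` of the total space
`π : End(TM) → M`, applied to a section `s` of `π^*End(TM)` over `S` and a tangent vector `U` to `S`
at `z ∈ S`. If `(e_i)` is the frame of `End(TM)` near `π z` defined by a local trivialization and
`s = ∑ f_i π^*e_i`, then `(π^*D)_U s = ∑ (U f_i) e_i + ∑ f_i(z) D_{π_* U} e_i`. The first sum is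
computed by differentiating within `S` the expression of `s` in the trivialization, and
`∑ f_i(z) e_i` is the local section `extend _ (s z)`. -/
def pullbackCov (D : CovariantDerivative 𝓘(ℝ, E) E (TangentSpace 𝓘(ℝ, E) : M → Type _))
    (S : Set (EndBundle E M)) (s : Π z : EndBundle E M, EndT E z.proj) (z : EndBundle E M)
    (U : TangentSpace (endModel E) z) : EndT E z.proj :=
  (trivializationAt (E →L[ℝ] E) (EndT E : M → Type _) z.proj).symmL ℝ z.proj
      (mvfderivWithin (endModel E)
        (fun w ↦ (trivializationAt (E →L[ℝ] E) (EndT E : M → Type _) z.proj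
          (⟨w.proj, s w⟩ : EndBundle E M)).2) S z U)
    + endCov D (extend (E →L[ℝ] E) (s z)) z.proj (projDeriv z U)

/-- The vertical part of a tangent vector `U` of the total space of `End(TM)`, with respect to the
horizontal distribution of `D`. It is `(π^*D)_U τ`, where `τ(z) = z` is the tautological section
of `π^*End(TM)`. -/
def verticalPart (D : CovariantDerivative 𝓘(ℝ, E) E (TangentSpace 𝓘(ℝ, E) : M → Type _))
    (z : EndBundle E M) (U : TangentSpace (endModel E) z) : EndT E z.proj :=
  pullbackCov D Set.univ (fun w ↦ w.2) z U

/-- The vertical tangent vector at `z` which is defined by an element `B` of the vector space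
`End(T_p M)`, the velocity of the curve `z + t B`. -/
def verticalLift (z : EndBundle E M) (B : EndT E z.proj) : TangentSpace (endModel E) z :=
  (mfderiv 𝓘(ℝ, ℝ) (endModel E) (fun t : ℝ ↦ (⟨z.proj, z.2 + t • B⟩ : EndBundle E M)) 0 (1 : ℝ) :
    E × (E →L[ℝ] E))

/-- The image `σ_* X` of `X ∈ T_p M` under the differential of the local section
`σ = extend _ z` of `End(TM)`, which satisfies `σ(p) = z`. -/
def sectionLift (z : EndBundle E M) (X : TangentSpace 𝓘(ℝ, E) z.proj) :
    TangentSpace (endModel E) z :=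
  (mfderiv 𝓘(ℝ, E) (endModel E) (secMap (extend (E →L[ℝ] E) z.2)) z.proj X : E × (E →L[ℝ] E))

/-- The horizontal lift of `X` at `z` with respect to `D`: it is `σ_* X - D_X σ` (the second term
being considered as a vertical vector), for a local section `σ` with `σ(p) = z`. -/
def horizontalLift (D : CovariantDerivative 𝓘(ℝ, E) E (TangentSpace 𝓘(ℝ, E) : M → Type _))
    (z : EndBundle E M) (X : TangentSpace 𝓘(ℝ, E) z.proj) : TangentSpace (endModel E) z :=
  sectionLift z X - verticalLift z (endCov D (extend (E →L[ℝ] E) z.2) z.proj X)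

/-- The almost complex structure `𝒥` of the twistor space: at `z = J ∈ Z` it is `J` on the
horizontal space (identified with `T_p M` by `π_*`), and `B ↦ J ∘ B` on the vertical space. -/
def twistorJ (D : CovariantDerivative 𝓘(ℝ, E) E (TangentSpace 𝓘(ℝ, E) : M → Type _))
    (z : EndBundle E M) (U : TangentSpace (endModel E) z) : TangentSpace (endModel E) z :=
  horizontalLift D z (z.2 (projDeriv z U)) + verticalLift z (z.2 ∘L verticalPart D z U)

/-! ## The vertical tangent bundle `Θ` and its sections -/

/-- The fibre `Θ_J` of the vertical tangent bundle at `z = J ∈ Z`: the `J`-anti-linear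
endomorphisms which belong to `Q`. Its complex structure is `B ↦ J ∘ B`. -/
def theta (Q : Π x : M, Submodule ℝ (EndT E x)) (z : EndBundle E M) : Set (EndT E z.proj) :=
  {B | B ∈ Q z.proj ∧ B ∘L z.2 = -(z.2 ∘L B)}

/-- The projection `Π_J B = (B + J ∘ B ∘ J) / 2` of `Q_p` onto `Θ_J`, for `z = J`. -/
def thetaProj (z : EndBundle E M) (B : EndT E z.proj) : EndT E z.proj :=
  (2⁻¹ : ℝ) • (B + z.2 ∘L B ∘L z.2)

/-- The distinguished section `Ã` of `Θ` which is defined by a section `A` of `Q`: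
`Ã(J) = Π_J (A)`. -/
def distinguishedSection (A : Π x : M, EndT E x) (z : EndBundle E M) : EndT E z.proj :=
  thetaProj z (A z.proj)

/-- The connection `∇ = Π ∘ π^*D` of `Θ`. -/
def thetaCov (Q : Π x : M, Submodule ℝ (EndT E x))
    (D : CovariantDerivative 𝓘(ℝ, E) E (TangentSpace 𝓘(ℝ, E) : M → Type _))
    (s : Π z : EndBundle E M, EndT E z.proj) (z : EndBundle E M)
    (U : TangentSpace (endModel E) z) : EndT E z.proj :=
  thetaProj z (pullbackCov D (twistorSpace Q) s z U)

/-- The operator `∂̄^D`, the `(0,1)`-part of `∇`: `∂̄_U s = (∇_U s + 𝒥 ∇_{𝒥 U} s) / 2`. -/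
def dbar (Q : Π x : M, Submodule ℝ (EndT E x))
    (D : CovariantDerivative 𝓘(ℝ, E) E (TangentSpace 𝓘(ℝ, E) : M → Type _))
    (s : Π z : EndBundle E M, EndT E z.proj) (z : EndBundle E M)
    (U : TangentSpace (endModel E) z) : EndT E z.proj :=
  (2⁻¹ : ℝ) • (thetaCov Q D s z U + z.2 ∘L thetaCov Q D s z (twistorJ D z U))

/-- `s` is a `∂̄^D`-holomorphic section of `Θ → Z`: a smooth section with `∂̄^D s = 0`. Only the
values of `s` on `Z` matter. -/
structure IsHolomorphicSection (Q : Π x : M, Submodule ℝ (EndT E x))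
    (D : CovariantDerivative 𝓘(ℝ, E) E (TangentSpace 𝓘(ℝ, E) : M → Type _))
    (s : Π z : EndBundle E M, EndT E z.proj) : Prop where
  mem_theta : ∀ z ∈ twistorSpace Q, s z ∈ theta Q z
  smooth : ContMDiffOn (endModel E) (endModel E) ∞
    (fun z ↦ (⟨z.proj, s z⟩ : EndBundle E M)) (twistorSpace Q)
  dbar_eq_zero : ∀ z ∈ twistorSpace Q, ∀ U ∈ twistorTangent Q z, dbar Q D s z U = 0

end Geometry

/-! ## Representations of `Sp(1)` -/

section Representations

/-- The standard representation `H = ℂ²` of `Sp(1) = SU(2)`, with its hermitian metric. -/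
abbrev Hrep : Type := EuclideanSpace ℂ (Fin 2)

/-- The hermitian metric of `H ⊗ (H ⊗ H)` induced by the one of `H`. -/
instance : NormedAddCommGroup (Hrep ⊗[ℂ] (Hrep ⊗[ℂ] Hrep)) :=
  TensorProduct.instNormedAddCommGroup

instance : InnerProductSpace ℂ (Hrep ⊗[ℂ] (Hrep ⊗[ℂ] Hrep)) :=
  TensorProduct.instInnerProductSpace

/-- The unitary basis `h, h̃ = q(h)` of `H`, where `q(v₀, v₁) = (- conj v₁, conj v₀)`. -/
def hb (i : Fin 2) : Hrep := EuclideanSpace.single i 1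

/-- The complex symplectic form `ω` of `H`, with `ω(h, h̃) = 1`; the hermitian metric is
`ω(v, q w)`. -/
def symp : Hrep →ₗ[ℂ] Hrep →ₗ[ℂ] ℂ :=
  LinearMap.mk₂ ℂ (fun v w ↦ v 0 * w 1 - v 1 * w 0)
    (by intros; simp; ring) (by intros; simp; ring) (by intros; simp; ring) (by intros; simp; ring)

/-- The symmetric square `S²(H) ⊂ H ⊗ H`. -/
def S2 : Submodule ℂ (Hrep ⊗[ℂ] Hrep) :=
  LinearMap.eqLocus (TensorProduct.comm ℂ Hrep Hrep).toLinearMap LinearMap.id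

/-- The action of `H ⊗ H ≅ H^* ⊗ H = End(H)` on `H`: `(h₁ ⊗ h₂) · v = ω(h₁, v) h₂`. -/
def act : Hrep ⊗[ℂ] Hrep →ₗ[ℂ] Hrep →ₗ[ℂ] Hrep :=
  TensorProduct.lift
    (LinearMap.mk₂ ℂ (fun h₁ h₂ ↦ (symp h₁).smulRight h₂)
      (by intros; ext; simp [add_mul]) (by intros; ext; simp [mul_assoc])
      (by intros; ext; simp) (by intros; ext; simp [mul_left_comm]))

/-- The standard basis `j₁, j₂, j₃` of the imaginary quaternions `sp(1)`, the real part of `S²(H)`: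
`j₁ = -i (h h̃ + h̃ h)`, `j₂ = -(h h + h̃ h̃)`, `j₃ = i (h̃ h̃ - h h)`. -/
def sp1 : Fin 3 → Hrep ⊗[ℂ] Hrep :=
  ![(-Complex.I) • (hb 0 ⊗ₜ hb 1 + hb 1 ⊗ₜ hb 0),
    -(hb 0 ⊗ₜ hb 0 + hb 1 ⊗ₜ hb 1),
    Complex.I • (hb 1 ⊗ₜ hb 1 - hb 0 ⊗ₜ hb 0)]

/-- The map `F : H ⊗ S²(H) → H`, `F(h, h₁ h₂ + h₂ h₁) = ω(h, h₁) h₂ + ω(h, h₂) h₁`. It is extended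
to `H ⊗ (H ⊗ H)` by `h ⊗ (h₁ ⊗ h₂) ↦ ω(h, h₁) h₂`. -/
def contractF : Hrep ⊗[ℂ] (Hrep ⊗[ℂ] Hrep) →ₗ[ℂ] Hrep :=
  TensorProduct.lift (-act.flip)

/-- The irreducible component `S³(H) = ker F` of `H ⊗ S²(H) ⊂ H ⊗ (H ⊗ H)`. -/
def S3 : Submodule ℂ (Hrep ⊗[ℂ] (Hrep ⊗[ℂ] Hrep)) :=
  LinearMap.range (S2.subtype.lTensor Hrep) ⊓ LinearMap.ker contractF

/-- The isomorphism `Hom(H, H ⊗ H) = H^* ⊗ (H ⊗ H) ≅ H ⊗ (H ⊗ H)` given by the identification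
`H ≅ H^*`, `h ↦ ω(h, ·)`: it is the inverse of `a ⊗ s ↦ (v ↦ ω(a, v) s)`. -/
def raise : (Hrep →ₗ[ℂ] Hrep ⊗[ℂ] Hrep) →ₗ[ℂ] Hrep ⊗[ℂ] (Hrep ⊗[ℂ] Hrep) where
  toFun L := hb 0 ⊗ₜ L (hb 1) - hb 1 ⊗ₜ L (hb 0)
  map_add' L L' := by simp only [LinearMap.add_apply, TensorProduct.tmul_add]; abel
  map_smul' c L := by
    simp only [LinearMap.smul_apply, TensorProduct.tmul_smul, smul_sub, RingHom.id_apply]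

end Representations

/-! ## The Penrose operator -/

section Penrose

variable {E : Type*} [NormedAddCommGroup E] [NormedSpace ℝ E]
  {M : Type*} [TopologicalSpace M] [ChartedSpace E M]

/-- The natural Euclidean metric `⟨A, B⟩ = -tr(A ∘ B) / dim M` of `Q`; admissible bases are
orthonormal. -/
def metricQ {x : M} (A B : EndT E x) : ℝ :=
  -(LinearMap.trace ℝ (TangentSpace 𝓘(ℝ, E) x) (A ∘L B).toLinearMap) / Module.finrank ℝ E

/-- The linear map which is defined on `Q_x` by an admissible basis `J` of `Q_x`, and which
identifies `Q_x` with the real part `sp(1)` of `S²(H)`: `∑ a_i J_i ↦ ∑ a_i j_i`, where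
`a_i = ⟨B, J_i⟩` are the coordinates of `B ∈ Q_x`. -/
def toS2 {x : M} (J : Fin 3 → EndT E x) : EndT E x →ₗ[ℝ] Hrep ⊗[ℂ] Hrep where
  toFun B := ∑ i, metricQ B (J i) • sp1 i
  map_add' B B' := by
    rw [← Finset.sum_add_distrib]
    refine Finset.sum_congr rfl fun i _ ↦ ?_
    rw [← add_smul]
    congr 1
    simp [metricQ, ContinuousLinearMap.add_comp]
    ring
  map_smul' c B := by
    rw [RingHom.id_apply, Finset.smul_sum]
    refine Finset.sum_congr rfl fun i _ ↦ ?_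
    rw [smul_smul]
    congr 1
    simp [metricQ, ContinuousLinearMap.smul_comp]
    ring

/-- The fibre of the (locally defined) bundle `𝐄` at `x`, relative to an admissible basis `J` of
`Q_x`: the space of those `ℂ`-linear maps `e : H → T_x M ⊗ ℂ` which intertwine `j_i` with `J_i`.
The map `e ⊗ h ↦ e(h)` is the isomorphism `𝐄 ⊗ 𝐇 ≅ TM ⊗ ℂ`, for which `J_i` acts as `Id ⊗ j_i`. -/
def Efibre {x : M} (J : Fin 3 → EndT E x) :
    Submodule ℂ (Hrep →ₗ[ℂ] ℂ ⊗[ℝ] TangentSpace 𝓘(ℝ, E) x) where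
  carrier := {e | ∀ (i : Fin 3) (h : Hrep),
    e (act (sp1 i) h) = (J i).toLinearMap.baseChange ℂ (e h)}
  add_mem' {e e'} he he' i h := by
    simp only [LinearMap.add_apply, map_add, he i h, he' i h]
  zero_mem' i h := by simp
  smul_mem' c e he i h := by
    simp only [LinearMap.smul_apply, map_smul, he i h]

/-- The projection `T^*M ⊗ Q → 𝐄^* ⊗ S³(𝐇) = Hom(𝐄, S³(𝐇))` at `x`, relative to an admissible basis
`J` of `Q_x`. Any `γ ∈ T_x^*M ⊗ Q_x` extends by complex linearity to `T_x M ⊗ ℂ = 𝐄 ⊗ 𝐇`, and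
defines, for `e ∈ 𝐄`, an element `h ↦ γ(e(h))` of `Hom(H, S²(H)) ≅ H ⊗ S²(H)`; the latter is
projected onto `S³(H)`, along the hermitian orthogonal of `S³(H)`. -/
def penroseProj {x : M} (J : Fin 3 → EndT E x)
    (γ : TangentSpace 𝓘(ℝ, E) x →L[ℝ] EndT E x) : Efibre J →ₗ[ℂ] S3 :=
  S3.orthogonalProjectionOnto.toLinearMap ∘ₗ raise ∘ₗ
    LinearMap.llcomp ℂ Hrep (ℂ ⊗[ℝ] TangentSpace 𝓘(ℝ, E) x) (Hrep ⊗[ℂ] Hrep)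
      ((toS2 J ∘ₗ γ.toLinearMap).liftBaseChange ℂ) ∘ₗ (Efibre J).subtype

variable [IsManifold 𝓘(ℝ, E) ∞ M] [FiniteDimensional ℝ E]

/-- The Penrose operator `P^D A`, the projection of `DA` to `𝐄^* ⊗ S³(𝐇)`, at `x` and relative to an
admissible basis `J` of `Q_x`. -/
def penroseOperator (D : CovariantDerivative 𝓘(ℝ, E) E (TangentSpace 𝓘(ℝ, E) : M → Type _))
    (A : Π x : M, EndT E x) (x : M) (J : Fin 3 → EndT E x) : Efibre J →ₗ[ℂ] S3 :=
  penroseProj J (endCov D A x)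

/-- `A` is a solution of the Penrose operator: `P^D A = 0`. -/
def IsPenroseSolution (Q : Π x : M, Submodule ℝ (EndT E x))
    (D : CovariantDerivative 𝓘(ℝ, E) E (TangentSpace 𝓘(ℝ, E) : M → Type _))
    (A : Π x : M, EndT E x) : Prop :=
  ∀ (x : M) (J : Fin 3 → EndT E x), IsAdmissibleBasis (Q x) J → penroseOperator D A x J = 0

end Penrose

end QuatTwistor

end

open QuatTwistor

/-! Fix `z ∈ Z` over `p`, put `γ = (DA)_p`, and let `U ∈ T_z Z` have base component `X = π_* U` and
vertical part `B ∈ Θ_z`. Since `Ã = (A + zAz)/2` and the derivative `(π^*D)_U` of the tautological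
section `z` is `B`, the Leibniz rule expresses `∇_U Ã` through `γ(X)` and `B`. Replacing `U` by `𝒥U`
replaces `(X, B)` by `(zX, zB)`, and the terms in `B` then cancel in `∂̄_U Ã` (`vertical_cancel`):
the restriction of `Ã` to a twistor line is always holomorphic. There remains `∂̄_U Ã = ½ (Π_z γ(X)
+ z Π_z γ(zX))`, which is `dbar_distinguishedSection`. As every `X` is the projection of a tangent
vector of `Z`, holomorphy becomes the vanishing of this expression for all `z` and `X`
(`isHolomorphicSection_iff`), a condition on `γ` at one point.

Write `γ = ∑ α_i ⊗ J_i` in an admissible basis. Both sides of the equivalence say that the three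
real `1`-forms `α_i ∘ J_i` coincide. For `∂̄` this is `IsQuatTriple.forall_dbar_eq_zero_iff`.
Necessity comes from testing `z = J 0` and `z = J 1`. For sufficiency, with `β` the common form,
`γ(X) = -∑ β(J_i X) J_i`, and a quaternion computation gives zero for every unit `z`. For the
Penrose projection this is `penroseProj_eq_zero_iff`. The orthogonal of `S³(H)` in `H ⊗ S²(H)` is
cut out by four linear equations (`raise_mem_S3_orthogonal_iff`), which on `h ↦ γ(e(h))`, with `e`
intertwining `j_i` and `J_i`, are the complexified equalities of the `α_i ∘ J_i`.

Tangent vectors of `Z` are velocities of curves, so the argument also needs that `U` is tangent to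
`Z` exactly when its vertical part lies in `Θ` (`verticalPart_mem_theta`, `mem_twistorTangent`). All
differential computations are made in the preferred trivialization at `p`, where `D = d + Γ` on
vectors and `D = d + [Γ, ·]` on endomorphisms. -/

noncomputable section

namespace QuatTwistor

/-! ### Representation theory: the equations of the orthogonal of `S³(H)` in `H ⊗ S²(H)`. -/

section Representations

lemma inner_hb (i j : Fin 2) : inner ℂ (hb i) (hb j) = if i = j then (1 : ℂ) else 0 := by
  simp [hb, EuclideanSpace.inner_single_left]

lemma inner_hb_right (v : Hrep) (i : Fin 2) : inner ℂ v (hb i) = (starRingEnd ℂ) (v i) := by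
  simp [hb, EuclideanSpace.inner_single_right]

lemma symp_apply (v w : Hrep) : symp v w = v 0 * w 1 - v 1 * w 0 := rfl

lemma act_tmul (a b v : Hrep) : act (a ⊗ₜ b) v = symp a v • b := rfl

lemma contractF_tmul (h : Hrep) (t : Hrep ⊗[ℂ] Hrep) : contractF (h ⊗ₜ t) = -act t h := rfl

lemma raise_apply (L : Hrep →ₗ[ℂ] Hrep ⊗[ℂ] Hrep) :
    raise L = hb 0 ⊗ₜ L (hb 1) - hb 1 ⊗ₜ L (hb 0) := rfl

/-- The action of `j₁, j₂, j₃` on `H`, in coordinates. -/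
lemma act_sp1 (h : Hrep) :
    act (sp1 0) h = (Complex.I * h 0) • hb 0 - (Complex.I * h 1) • hb 1 ∧
    act (sp1 1) h = h 0 • hb 1 - h 1 • hb 0 ∧
    act (sp1 2) h = -((Complex.I * h 0) • hb 1 + (Complex.I * h 1) • hb 0) := by
  refine ⟨?_, ?_, ?_⟩ <;> ext k <;> fin_cases k <;>
    simp [sp1, act_tmul, symp_apply, hb]

/-- Coordinates of elements of `S³(H)` are symmetric in the last two indices. -/
lemma inner_S3_swap {s : Hrep ⊗[ℂ] (Hrep ⊗[ℂ] Hrep)} (hs : s ∈ S3) (i j k : Fin 2) :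
    inner ℂ s (hb i ⊗ₜ[ℂ] (hb j ⊗ₜ[ℂ] hb k)) = inner ℂ s (hb i ⊗ₜ[ℂ] (hb k ⊗ₜ[ℂ] hb j)) := by
  obtain ⟨t, rfl⟩ := hs.1
  clear hs
  induction t using TensorProduct.induction_on with
  | zero => simp
  | add x y hx hy => rw [map_add, inner_add_left, inner_add_left, hx, hy]
  | tmul h q =>
    have hq : TensorProduct.comm ℂ Hrep Hrep (q : Hrep ⊗[ℂ] Hrep) = q := q.2
    rw [LinearMap.lTensor_tmul, TensorProduct.inner_tmul, TensorProduct.inner_tmul]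
    congr 1
    have := TensorProduct.inner_comm_comm (𝕜 := ℂ) (q : Hrep ⊗[ℂ] Hrep) (hb j ⊗ₜ[ℂ] hb k)
    rw [hq] at this
    exact this.symm

/-- This is the adjoint of `F` on the basis: since `F(h ⊗ (a ⊗ b)) = ω(h, a) b`, only the `01` and
`10` entries of the first two factors contribute. -/
lemma inner_contractF (s : Hrep ⊗[ℂ] (Hrep ⊗[ℂ] Hrep)) (k : Fin 2) :
    inner ℂ (contractF s) (hb k) = inner ℂ s (hb 0 ⊗ₜ[ℂ] (hb 1 ⊗ₜ[ℂ] hb k)) -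
      inner ℂ s (hb 1 ⊗ₜ[ℂ] (hb 0 ⊗ₜ[ℂ] hb k)) := by
  induction s using TensorProduct.induction_on with
  | zero => simp
  | add x y hx hy => rw [map_add]; simp only [inner_add_left, hx, hy]; ring
  | tmul h t =>
    induction t using TensorProduct.induction_on with
    | zero => simp
    | add x y hx hy =>
      rw [TensorProduct.tmul_add, map_add]; simp only [inner_add_left, hx, hy]; ring
    | tmul a b =>
      rw [contractF_tmul, act_tmul]
      simp only [TensorProduct.inner_tmul, inner_neg_left, inner_smul_left, inner_hb_right,
        symp_apply, map_sub, map_mul]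
      ring

/-- The kernel of `F` gives symmetry in the first two indices. Together with `inner_S3_swap` it
makes the coordinates of elements of `S³(H)` totally symmetric. -/
lemma inner_S3_contract {s : Hrep ⊗[ℂ] (Hrep ⊗[ℂ] Hrep)} (hs : s ∈ S3) (k : Fin 2) :
    inner ℂ s (hb 0 ⊗ₜ[ℂ] (hb 1 ⊗ₜ[ℂ] hb k)) = inner ℂ s (hb 1 ⊗ₜ[ℂ] (hb 0 ⊗ₜ[ℂ] hb k)) := by
  have h := inner_contractF s k
  rw [show contractF s = 0 from hs.2, inner_zero_left] at h
  exact (sub_eq_zero.1 h.symm)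

/-- Two summands are enough for the test tensors needed below: one for each basis vector in the
first factor. -/
lemma mem_S3_of_add {h₁ h₂ : Hrep} {q₁ q₂ : Hrep ⊗[ℂ] Hrep} (hq₁ : q₁ ∈ S2) (hq₂ : q₂ ∈ S2)
    (h : contractF (h₁ ⊗ₜ q₁ + h₂ ⊗ₜ q₂) = 0) : h₁ ⊗ₜ q₁ + h₂ ⊗ₜ q₂ ∈ S3 :=
  ⟨⟨h₁ ⊗ₜ ⟨q₁, hq₁⟩ + h₂ ⊗ₜ ⟨q₂, hq₂⟩, by simp⟩, h⟩

lemma tmul_self_mem_S2 (h : Hrep) : h ⊗ₜ[ℂ] h ∈ S2 := rfl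

lemma symm_mem_S2 (h k : Hrep) : h ⊗ₜ[ℂ] k + k ⊗ₜ[ℂ] h ∈ S2 := by
  change TensorProduct.comm ℂ Hrep Hrep _ = _
  simp [add_comm]

/-- The equations of the orthogonal of `S³(H)` in `H ⊗ S²(H)`. -/
lemma raise_mem_S3_orthogonal_iff (L : Hrep →ₗ[ℂ] Hrep ⊗[ℂ] Hrep) (x y : Fin 3 → ℂ)
    (hx : L (hb 0) = ∑ i, x i • sp1 i) (hy : L (hb 1) = ∑ i, y i • sp1 i) :
    raise L ∈ S3ᗮ ↔
      x 1 = Complex.I * x 2 ∧ y 0 = x 2 ∧ y 1 = Complex.I * x 0 ∧ y 2 = -x 0 := by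
  have hI : Complex.I * Complex.I = -1 := Complex.I_mul_I
  -- The pairing is expanded in the eight coordinates of `s`, so that both directions become linear
  -- algebra in `x` and `y`.
  have hr (s : Hrep ⊗[ℂ] (Hrep ⊗[ℂ] Hrep)) : inner ℂ s (raise L) =
      -(Complex.I * y 0) * (inner ℂ s (hb 0 ⊗ₜ[ℂ] (hb 0 ⊗ₜ[ℂ] hb 1)) +
          inner ℂ s (hb 0 ⊗ₜ[ℂ] (hb 1 ⊗ₜ[ℂ] hb 0)))
        - (y 1 + Complex.I * y 2) * inner ℂ s (hb 0 ⊗ₜ[ℂ] (hb 0 ⊗ₜ[ℂ] hb 0))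
        + (Complex.I * y 2 - y 1) * inner ℂ s (hb 0 ⊗ₜ[ℂ] (hb 1 ⊗ₜ[ℂ] hb 1))
        + (Complex.I * x 0) * (inner ℂ s (hb 1 ⊗ₜ[ℂ] (hb 0 ⊗ₜ[ℂ] hb 1)) +
          inner ℂ s (hb 1 ⊗ₜ[ℂ] (hb 1 ⊗ₜ[ℂ] hb 0)))
        + (x 1 + Complex.I * x 2) * inner ℂ s (hb 1 ⊗ₜ[ℂ] (hb 0 ⊗ₜ[ℂ] hb 0))
        - (Complex.I * x 2 - x 1) * inner ℂ s (hb 1 ⊗ₜ[ℂ] (hb 1 ⊗ₜ[ℂ] hb 1)) := by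
    rw [raise_apply, hx, hy]
    simp only [Fin.sum_univ_three, sp1, Matrix.cons_val_zero, Matrix.cons_val_one, Matrix.cons_val,
      TensorProduct.tmul_add, TensorProduct.tmul_sub, TensorProduct.tmul_smul,
      TensorProduct.tmul_neg, inner_sub_right, inner_add_right, inner_smul_right, inner_neg_right]
    ring
  rw [Submodule.mem_orthogonal]
  constructor
  · intro h
    -- The four test tensors are the symmetric cubes of `hb 0` and `hb 1` and the two mixed
    -- symmetric tensors, a basis of `S³(H)`. The pure cubes take the second summand to be zero.
    have h000 := h _ (mem_S3_of_add (h₁ := hb 0) (h₂ := 0) (tmul_self_mem_S2 (hb 0))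
      (tmul_self_mem_S2 (hb 0)) (by simp [contractF_tmul, act_tmul, symp_apply, hb]))
    have h111 := h _ (mem_S3_of_add (h₁ := hb 1) (h₂ := 0) (tmul_self_mem_S2 (hb 1))
      (tmul_self_mem_S2 (hb 0)) (by simp [contractF_tmul, act_tmul, symp_apply, hb]))
    have h001 := h _ (mem_S3_of_add (h₁ := hb 0) (h₂ := hb 1) (symm_mem_S2 (hb 0) (hb 1))
      (tmul_self_mem_S2 (hb 0)) (by simp [contractF_tmul, act_tmul, symp_apply, hb]))
    have h011 := h _ (mem_S3_of_add (h₁ := hb 0) (h₂ := hb 1) (tmul_self_mem_S2 (hb 1))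
      (symm_mem_S2 (hb 0) (hb 1)) (by simp [contractF_tmul, act_tmul, symp_apply, hb]))
    rw [hr] at h000 h111 h001 h011
    simp only [TensorProduct.tmul_add, TensorProduct.zero_tmul, inner_add_left, inner_zero_left,
      TensorProduct.inner_tmul, inner_hb, Fin.isValue, zero_ne_one, one_ne_zero, if_true,
      if_false] at h000 h111 h001 h011
    refine ⟨?_, ?_, ?_, ?_⟩
    · linear_combination h111
    · linear_combination (Complex.I / 2) * (h001 - h111) + (y 0 - x 2) * hI
    · linear_combination (-1/2 : ℂ) * (h000 + h011)
    · linear_combination (-Complex.I / 2) * (h011 - h000) + (y 2 + x 0) * hI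
  · rintro ⟨h1, h2, h3, h4⟩ s hs
    -- Total symmetry leaves only the coordinates with 0, 1, 2 or 3 indices equal to `1`, and the
    -- coefficient of each of them vanishes.
    rw [hr, h1, h2, h3, h4, ← inner_S3_contract hs 0, ← inner_S3_contract hs 1,
      inner_S3_swap hs 0 1 0, inner_S3_swap hs 1 1 0, ← inner_S3_contract hs 1]
    ring

end Representations

/-! ### Quaternion algebra in a real algebra. -/

/-- Three elements of a ring that satisfy the quaternionic relations. -/
structure IsQuatTriple {R : Type*} [Ring R] (I : Fin 3 → R) : Prop where
  sq : ∀ i, I i * I i = -1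
  mul01 : I 0 * I 1 = I 2
  mul12 : I 1 * I 2 = I 0
  mul20 : I 2 * I 0 = I 1

namespace IsQuatTriple

variable {R : Type*} [Ring R] {I : Fin 3 → R} (h : IsQuatTriple I)
include h

lemma mul10 : I 1 * I 0 = -I 2 := by
  rw [← h.mul12, ← mul_assoc, h.sq, neg_one_mul]

lemma mul21 : I 2 * I 1 = -I 0 := by
  rw [← h.mul20, ← mul_assoc, h.sq, neg_one_mul]

lemma mul02 : I 0 * I 2 = -I 1 := by
  rw [← h.mul01, ← mul_assoc, h.sq, neg_one_mul]

variable [Algebra ℝ R]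

/-- The product of imaginary quaternions: minus the scalar product plus the cross product. -/
lemma mul_combination (u w : Fin 3 → ℝ) :
    (∑ i, u i • I i) * (∑ i, w i • I i) = (-(∑ i, u i * w i)) • (1 : R) +
      (u 1 * w 2 - u 2 * w 1) • I 0 + (u 2 * w 0 - u 0 * w 2) • I 1 +
      (u 0 * w 1 - u 1 * w 0) • I 2 := by
  simp only [Fin.sum_univ_three, add_mul, mul_add, smul_mul_smul_comm, h.sq, h.mul01, h.mul12,
    h.mul20, h.mul10, h.mul21, h.mul02]
  module

lemma anticomm_combination (u w : Fin 3 → ℝ) :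
    (∑ i, u i • I i) * (∑ i, w i • I i) + (∑ i, w i • I i) * (∑ i, u i • I i) =
      (-2 * ∑ i, u i * w i) • (1 : R) := by
  rw [h.mul_combination, h.mul_combination]
  simp only [Fin.sum_univ_three]
  module

lemma sq_combination (u : Fin 3 → ℝ) :
    (∑ i, u i • I i) * (∑ i, u i • I i) = (-(∑ i, u i * u i)) • (1 : R) := by
  rw [h.mul_combination]
  simp only [Fin.sum_univ_three]
  module

lemma sum_sq_eq_one [Nontrivial R] {u : Fin 3 → ℝ}
    (hu : (∑ i, u i • I i) * (∑ i, u i • I i) = -1) : ∑ i, u i * u i = 1 := by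
  rw [h.sq_combination] at hu
  have h1 : (1 - ∑ i, u i * u i) • (1 : R) = 0 := by
    rw [sub_smul, one_smul, sub_eq_add_neg, ← neg_smul, hu, add_neg_cancel]
  rcases smul_eq_zero.1 h1 with h2 | h2
  · linarith
  · exact absurd h2 one_ne_zero

/-- The algebraic identity behind the vanishing of `∂̄` on forms of type `∑ α(J_i X) J_i`. -/
lemma combination_identity {u : Fin 3 → ℝ} (hu : ∑ i, u i * u i = 1) (b : ℝ) (c c' : Fin 3 → ℝ)
    (hc0 : c' 0 = u 0 * b + u 1 * c 2 - u 2 * c 1) (hc1 : c' 1 = u 1 * b + u 2 * c 0 - u 0 * c 2)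
    (hc2 : c' 2 = u 2 * b + u 0 * c 1 - u 1 * c 0) {z G G' : R} (hz : z = ∑ i, u i • I i)
    (hG : G = ∑ i, c i • I i) (hG' : G' = ∑ i, c' i • I i) :
    (G + z * (G * z)) + z * (G' + z * (G' * z)) = 0 := by
  have hzz : z * z = -1 := by rw [hz, h.sq_combination, hu, neg_one_smul]
  -- The hypotheses say `c' = b u + u × c`. Hence `u · c' = b` and `u × c' = (u · c) u - c`, so the
  -- part `c` cancels and `G + zG'` lies in the span of `1` and `z`. It thus commutes with `z`, and
  -- `K + zKz = K + Kz² = 0` for such `K`.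
  have hK : G + z * G' = (-b) • (1 : R) + (∑ i, u i * c i) • z := by
    rw [hG, hG', hz, h.mul_combination, hc0, hc1, hc2]
    simp only [Fin.sum_univ_three] at hu ⊢
    rw [hc0, hc1, hc2]
    -- Multiplying by `|u|² = 1` makes both sides homogeneous in `u`, so that they agree as
    -- polynomials.
    have e (k : ℝ) : k = (u 0 * u 0 + u 1 * u 1 + u 2 * u 2) * k := by rw [hu, one_mul]
    rw [e (-b)]
    nth_rewrite 1 [e (c 0), e (c 1), e (c 2)]
    module
  have h1 : (G + z * (G * z)) + z * (G' + z * (G' * z)) =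
      (G + z * G') + z * ((G + z * G') * z) := by
    noncomm_ring
  rw [h1, hK, add_mul, smul_mul_assoc, smul_mul_assoc, hzz, one_mul, mul_add, mul_smul_comm,
    mul_smul_comm, hzz]
  simp
  abel

end IsQuatTriple

/-- Terms that involve the vertical part `B` of a tangent vector cancel in `∂̄ Ã`. -/
lemma vertical_cancel {R : Type*} [Ring R] {z A B G G' : R} (hz : z * z = -1)
    (hB : B * z = -(z * B)) :
    (G + B * (A * z) + z * (G * z) + z * (A * B)) +
      z * ((G + B * (A * z) + z * (G * z) + z * (A * B)) * z) +
    z * ((G' + (z * B) * (A * z) + z * (G' * z) + z * (A * (z * B))) +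
      z * ((G' + (z * B) * (A * z) + z * (G' * z) + z * (A * (z * B))) * z)) =
    2 * ((G + z * (G * z)) + z * (G' + z * (G' * z))) := by
  -- In `T + zT'`, with `T` and `T'` the parts of the two brackets that contain `B`, there remains
  -- `K = zAB - AzB`. It satisfies `zKz = -K`, so it is annihilated by `K ↦ K + zKz`. The factor 2
  -- on the right appears because this map, applied twice, is twice itself.
  have r1 (w : R) : z * (z * w) = -w := by rw [← mul_assoc, hz, neg_one_mul]
  simp only [mul_add, add_mul, mul_assoc, mul_neg, r1, hz, hB, neg_neg, mul_one,
    two_mul]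
  abel

/-! ### The trace metric and the pointwise form of the `∂̄` equation. -/

section Metric

variable {V : Type*} [NormedAddCommGroup V] [NormedSpace ℝ V]

/-- The normalized trace `-tr(T) / dim V` of an endomorphism. -/
def normTrace (T : V →L[ℝ] V) : ℝ := -(LinearMap.trace ℝ V T.toLinearMap) / Module.finrank ℝ V

lemma normTrace_add (S T : V →L[ℝ] V) : normTrace (S + T) = normTrace S + normTrace T := by
  simp [normTrace]; ring

lemma normTrace_smul (c : ℝ) (T : V →L[ℝ] V) : normTrace (c • T) = c * normTrace T := by
  simp [normTrace]; ring

lemma normTrace_neg (T : V →L[ℝ] V) : normTrace (-T) = -normTrace T := by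
  simp [normTrace, neg_div]

lemma normTrace_mul_comm (S T : V →L[ℝ] V) : normTrace (S * T) = normTrace (T * S) := by
  unfold normTrace
  congr 2
  exact LinearMap.trace_mul_comm ℝ S.toLinearMap T.toLinearMap

lemma normTrace_neg_one (hd : Module.finrank ℝ V ≠ 0) : normTrace (-1 : V →L[ℝ] V) = 1 := by
  have := Module.finite_of_finrank_pos (Nat.pos_of_ne_zero hd)
  have : LinearMap.trace ℝ V (1 : V →L[ℝ] V).toLinearMap = Module.finrank ℝ V :=
    LinearMap.trace_one ℝ V
  rw [normTrace_neg, normTrace, this]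
  field_simp

/-- Each `I k` is a product of two anti-commuting elements, so its trace equals its own negative.
This gives orthogonality. -/
lemma IsQuatTriple.normTrace_mul {I : Fin 3 → V →L[ℝ] V} (h : IsQuatTriple I)
    (hd : Module.finrank ℝ V ≠ 0) (i j : Fin 3) :
    normTrace (I i * I j) = if i = j then 1 else 0 := by
  have h01 : normTrace (I 2) = 0 := by
    have := normTrace_mul_comm (I 0) (I 1)
    rw [h.mul01, h.mul10, normTrace_neg] at this; linarith
  have h12 : normTrace (I 0) = 0 := by
    have := normTrace_mul_comm (I 1) (I 2)
    rw [h.mul12, h.mul21, normTrace_neg] at this; linarith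
  have h20 : normTrace (I 1) = 0 := by
    have := normTrace_mul_comm (I 2) (I 0)
    rw [h.mul20, h.mul02, normTrace_neg] at this; linarith
  fin_cases i <;> fin_cases j <;>
    simp [h.sq, h.mul01, h.mul12, h.mul20, h.mul10, h.mul21, h.mul02, normTrace_neg, h01, h12, h20,
      ← normTrace_neg_one hd]

lemma IsQuatTriple.normTrace_combination {I : Fin 3 → V →L[ℝ] V} (h : IsQuatTriple I)
    (hd : Module.finrank ℝ V ≠ 0) (u : Fin 3 → ℝ) (j : Fin 3) :
    normTrace ((∑ i, u i • I i) * I j) = u j := by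
  simp only [Fin.sum_univ_three, add_mul, smul_mul_assoc, normTrace_add, normTrace_smul,
    h.normTrace_mul hd]
  fin_cases j <;> simp

/-- Coordinates in the basis are given by traces, hence by a fixed continuous linear form; this
later shows that they are differentiable along curves. -/
lemma IsQuatTriple.eq_sum_normTrace {I : Fin 3 → V →L[ℝ] V} (h : IsQuatTriple I)
    (hd : Module.finrank ℝ V ≠ 0) {T : V →L[ℝ] V} (hT : T ∈ Submodule.span ℝ (Set.range I)) :
    T = ∑ i, normTrace (T * I i) • I i := by
  obtain ⟨u, rfl⟩ := (Submodule.mem_span_range_iff_exists_fun ℝ).1 hT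
  simp only [h.normTrace_combination hd]

/-- Pairing the `∂̄` expression at `z` with an orthogonal unit `p`, where `q = zp`, isolates a
single coordinate of `G` and one of `G'`. -/
lemma normTrace_dbar {z p q G G' : V →L[ℝ] V} (hz : z * z = -1) (hzp : z * p = q)
    (hpz : p * z = -q) (hqz : q * z = p) :
    normTrace (((G + z * (G * z)) + z * (G' + z * (G' * z))) * p) =
      2 * normTrace (G * p) - 2 * normTrace (G' * q) := by
  have h1 : ((G + z * (G * z)) + z * (G' + z * (G' * z))) * p =
      G * p + z * (G * q) + z * (G' * p) + -(G' * q) := by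
    rw [← hzp, mul_add z G', ← mul_assoc z z, hz]; noncomm_ring
  rw [h1, normTrace_add, normTrace_add, normTrace_add, normTrace_neg, normTrace_mul_comm z,
    normTrace_mul_comm z, mul_assoc, mul_assoc, hqz, hpz, mul_neg, normTrace_neg]
  ring

/-- The right-hand side says that the `1`-forms `α_i ∘ I_i` coincide, where `α_i` is the coordinate
of `γ` along `I i`. -/
lemma IsQuatTriple.forall_dbar_eq_zero_iff {I : Fin 3 → V →L[ℝ] V} (h : IsQuatTriple I)
    (hd : Module.finrank ℝ V ≠ 0) {S : Submodule ℝ (V →L[ℝ] V)}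
    (hS : Submodule.span ℝ (Set.range I) = S) (γ : V →L[ℝ] V →L[ℝ] V) (hγ : ∀ X, γ X ∈ S) :
    (∀ z ∈ S, z * z = -1 → ∀ X,
      (γ X + z * (γ X * z)) + z * (γ (z X) + z * (γ (z X) * z)) = 0) ↔
    ∀ X, normTrace (γ (I 0 X) * I 0) = normTrace (γ (I 1 X) * I 1) ∧
      normTrace (γ (I 1 X) * I 1) = normTrace (γ (I 2 X) * I 2) := by
  subst hS
  have hV : Nontrivial V := Module.nontrivial_of_finrank_pos (Nat.pos_of_ne_zero hd)
  have hs (i : Fin 3) (X : V) : I i (I i X) = -X := DFunLike.congr_fun (h.sq i) X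
  have h01 (X : V) : I 0 (I 1 X) = I 2 X := DFunLike.congr_fun h.mul01 X
  have h12 (X : V) : I 1 (I 2 X) = I 0 X := DFunLike.congr_fun h.mul12 X
  have h20 (X : V) : I 2 (I 0 X) = I 1 X := DFunLike.congr_fun h.mul20 X
  have h10 (X : V) : I 1 (I 0 X) = -I 2 X := DFunLike.congr_fun h.mul10 X
  have h21 (X : V) : I 2 (I 1 X) = -I 0 X := DFunLike.congr_fun h.mul21 X
  have h02 (X : V) : I 0 (I 2 X) = -I 1 X := DFunLike.congr_fun h.mul02 X
  constructor
  · intro H X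
    -- With `z = I 0`, `p = I 1` and the vector `I 1 X`, one has `zp = I 2` and `z(I 1 X) = I 2 X`,
    -- so the equation compares the forms of index 1 and 2. The cyclic shift `e1` compares those of
    -- index 2 and 0.
    have e0 := congrArg (fun T ↦ normTrace (T * I 1))
      (H (I 0) (Submodule.subset_span (Set.mem_range_self 0)) (h.sq 0) (I 1 X))
    have e1 := congrArg (fun T ↦ normTrace (T * I 2))
      (H (I 1) (Submodule.subset_span (Set.mem_range_self 1)) (h.sq 1) (I 2 X))
    simp only [normTrace_dbar (h.sq 0) h.mul01 h.mul10 h.mul20, zero_mul, h01] at e0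
    simp only [normTrace_dbar (h.sq 1) h.mul12 h.mul21 h.mul01, zero_mul, h12] at e1
    have e2 : normTrace (0 : V →L[ℝ] V) = 0 := by simp [normTrace]
    constructor <;> linarith
  · intro H z hz hzz X
    obtain ⟨u, rfl⟩ := (Submodule.mem_span_range_iff_exists_fun ℝ).1 hz
    have hu := h.sum_sq_eq_one hzz
    -- Writing `Y = -I_i(I_i Y)` turns `α_i(Y)` into `-(α_i ∘ I_i)(I_i Y)`, in which the common form
    -- may be taken with index 0.
    have hc (i : Fin 3) (Y : V) : normTrace (γ Y * I i) = -normTrace (γ (I 0 (I i Y)) * I 0) := by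
      have hY : Y = -(I i (I i Y)) := by rw [hs, neg_neg]
      have hi : normTrace (γ (I i (I i Y)) * I i) = normTrace (γ (I 0 (I i Y)) * I 0) := by
        fin_cases i
        · rfl
        · exact (H _).1.symm
        · exact ((H _).1.trans (H _).2).symm
      nth_rewrite 1 [hY]
      rw [map_neg, neg_mul, normTrace_neg, hi]
    set β : V → ℝ := fun Y ↦ normTrace (γ (I 0 Y) * I 0) with hβ
    have hβa (Y Y' : V) : β (Y + Y') = β Y + β Y' := by
      simp only [hβ, map_add, add_mul, normTrace_add]
    have hβs (c : ℝ) (Y : V) : β (c • Y) = c * β Y := by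
      simp only [hβ, map_smul, smul_mul_assoc, normTrace_smul]
    have hβn (Y : V) : β (-Y) = -β Y := by
      simp only [hβ, map_neg, neg_mul, normTrace_neg]
    have hγ' (Y : V) : γ Y = ∑ i, (-β (I i Y)) • I i := by
      exact (h.eq_sum_normTrace hd (hγ Y)).trans (Finset.sum_congr rfl fun i _ ↦ by rw [hc])
    -- Here `c_i = -β(I_i X)` and `c'_i = -β(I_i z X)`. Expanding `I_i z` by the multiplication
    -- table gives `c' = β(X) u + u × c`.
    refine h.combination_identity hu (β X) _ _ ?_ ?_ ?_ rfl (hγ' X) (hγ' _) <;>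
    · simp only [Fin.sum_univ_three, add_apply, smul_apply, map_add, map_smul, hs, h01, h12,
        h20, h10, h21, h02, hβa, hβs, hβn]
      ring

end Metric

/-! ### Translation of the quaternion algebra to admissible bases of `Q_x`. -/

section AdmissibleBasis

variable {E : Type*} [NormedAddCommGroup E] [NormedSpace ℝ E]
  {M : Type*} [TopologicalSpace M] [ChartedSpace E M] {x : M}

lemma IsAdmissibleBasis.isQuatTriple {Qx : Submodule ℝ (EndT E x)} {J : Fin 3 → EndT E x}
    (hJ : IsAdmissibleBasis Qx J) : IsQuatTriple (R := E →L[ℝ] E) J where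
  sq := hJ.sq
  mul01 := hJ.mul_zero_one
  mul12 := hJ.mul_one_two
  mul20 := hJ.mul_two_zero

lemma IsAdmissibleBasis.eq_sum_metricQ {Qx : Submodule ℝ (EndT E x)} {J : Fin 3 → EndT E x}
    (hJ : IsAdmissibleBasis Qx J) (hd : Module.finrank ℝ E ≠ 0) {B : EndT E x} (hB : B ∈ Qx) :
    B = ∑ i, metricQ B (J i) • J i := by
  have hB' : B ∈ Submodule.span ℝ (Set.range J) := hJ.span_eq ▸ hB
  exact IsQuatTriple.eq_sum_normTrace (V := E) hJ.isQuatTriple hd hB'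

lemma IsAdmissibleBasis.mem {Qx : Submodule ℝ (EndT E x)} {J : Fin 3 → EndT E x}
    (hJ : IsAdmissibleBasis Qx J) (i : Fin 3) : J i ∈ Qx :=
  hJ.span_eq ▸ Submodule.subset_span (Set.mem_range_self i)

/-- The pointwise form of the equation `∂̄ Ã = 0`, in terms of an admissible basis. -/
theorem forall_thetaProj_add_eq_zero_iff {Qx : Submodule ℝ (EndT E x)} {J : Fin 3 → EndT E x}
    (hJ : IsAdmissibleBasis Qx J) (hd : Module.finrank ℝ E ≠ 0)
    (γ : TangentSpace 𝓘(ℝ, E) x →L[ℝ] EndT E x) (hγ : ∀ X, γ X ∈ Qx) :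
    (∀ z ∈ Qx, z ∘L z = -ContinuousLinearMap.id ℝ (TangentSpace 𝓘(ℝ, E) x) →
      ∀ X, thetaProj ⟨x, z⟩ (γ X) + z ∘L thetaProj ⟨x, z⟩ (γ (z X)) = 0) ↔
    ∀ X, metricQ (γ (J 0 X)) (J 0) = metricQ (γ (J 1 X)) (J 1) ∧
      metricQ (γ (J 1 X)) (J 1) = metricQ (γ (J 2 X)) (J 2) := by
  have hR (z : EndT E x) (X : TangentSpace 𝓘(ℝ, E) x) :
      thetaProj ⟨x, z⟩ (γ X) + z ∘L thetaProj ⟨x, z⟩ (γ (z X)) =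
      (2⁻¹ : ℝ) • ((γ X + z * (γ X * z)) + z * (γ (z X) + z * (γ (z X) * z))) := by
    rw [smul_add, ← mul_smul_comm]; rfl
  refine Iff.trans ?_
    (IsQuatTriple.forall_dbar_eq_zero_iff (V := E) hJ.isQuatTriple hd hJ.span_eq γ hγ)
  refine forall₄_congr fun z hz hzz X ↦ ?_
  rw [hR, smul_eq_zero_iff_right (by norm_num)]
  rfl

end AdmissibleBasis

/-! ### The kernel of the Penrose projection at a point. -/

section PenroseProjection

variable {E : Type*} [NormedAddCommGroup E] [NormedSpace ℝ E]
  {M : Type*} [TopologicalSpace M] [ChartedSpace E M] {x : M}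

/-- The complex-linear extension to `T_x M ⊗ ℂ` of the `i`-th coordinate `X ↦ ⟨γ(X), J_i⟩` of
`γ ∈ T_x^*M ⊗ Q_x`. -/
def complexCoord (J : Fin 3 → EndT E x) (γ : TangentSpace 𝓘(ℝ, E) x →L[ℝ] EndT E x) (i : Fin 3) :
    ℂ ⊗[ℝ] TangentSpace 𝓘(ℝ, E) x →ₗ[ℂ] ℂ :=
  LinearMap.liftBaseChange ℂ
    { toFun := fun X ↦ ((metricQ (γ X) (J i) : ℝ) : ℂ)
      map_add' := fun X Y ↦ by
        rw [map_add, ← Complex.ofReal_add]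
        exact congrArg _ (normTrace_add (V := E) (γ X * J i) (γ Y * J i))
      map_smul' := fun c X ↦ by
        rw [map_smul, RingHom.id_apply, Complex.real_smul, ← Complex.ofReal_mul]
        exact congrArg _ (normTrace_smul (V := E) c (γ X * J i)) }

lemma complexCoord_tmul (J : Fin 3 → EndT E x) (γ : TangentSpace 𝓘(ℝ, E) x →L[ℝ] EndT E x)
    (i : Fin 3) (c : ℂ) (X : TangentSpace 𝓘(ℝ, E) x) :
    complexCoord J γ i (c ⊗ₜ X) = c * (metricQ (γ X) (J i) : ℝ) :=
  LinearMap.liftBaseChange_tmul ..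

lemma liftBaseChange_toS2 (J : Fin 3 → EndT E x) (γ : TangentSpace 𝓘(ℝ, E) x →L[ℝ] EndT E x)
    (v : ℂ ⊗[ℝ] TangentSpace 𝓘(ℝ, E) x) :
    (toS2 J ∘ₗ γ.toLinearMap).liftBaseChange ℂ v = ∑ i, complexCoord J γ i v • sp1 i := by
  induction v using TensorProduct.induction_on with
  | zero => simp
  | add v w hv hw => simp only [map_add, hv, hw, add_smul, Finset.sum_add_distrib]
  | tmul c X =>
    simp only [complexCoord_tmul, LinearMap.liftBaseChange_tmul, mul_smul, ← Finset.smul_sum]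
    rfl

/-- The complex-linear extension of `J_i`. -/
abbrev complexJ (J : Fin 3 → EndT E x) (i : Fin 3) :
    ℂ ⊗[ℝ] TangentSpace 𝓘(ℝ, E) x →ₗ[ℂ] ℂ ⊗[ℝ] TangentSpace 𝓘(ℝ, E) x :=
  (J i).toLinearMap.baseChange ℂ

lemma complexJ_comp (J : Fin 3 → EndT E x) {i j k : Fin 3} (h : J i ∘L J j = J k)
    (v : ℂ ⊗[ℝ] TangentSpace 𝓘(ℝ, E) x) : complexJ J i (complexJ J j v) = complexJ J k v := by
  induction v using TensorProduct.induction_on with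
  | zero => simp
  | add v w hv hw => simp only [map_add, hv, hw]
  | tmul c X =>
    simp only [complexJ, LinearMap.baseChange_tmul]
    rw [← h]; rfl

variable {Qx : Submodule ℝ (EndT E x)} {J : Fin 3 → EndT E x}

lemma IsAdmissibleBasis.complexJ_sq (hJ : IsAdmissibleBasis Qx J) (i : Fin 3)
    (v : ℂ ⊗[ℝ] TangentSpace 𝓘(ℝ, E) x) : complexJ J i (complexJ J i v) = -v := by
  induction v using TensorProduct.induction_on with
  | zero => simp
  | add v w hv hw => simp only [map_add, hv, hw, neg_add]
  | tmul c X =>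
    simp only [complexJ, LinearMap.baseChange_tmul, ← TensorProduct.tmul_neg]
    exact congrArg _ (DFunLike.congr_fun (hJ.sq i) X)

/-- The element of the fibre of `𝐄` defined by a vector `v` of type `(1, 0)` with respect to
`J_1`. -/
def efibreOf (J : Fin 3 → EndT E x) (v : ℂ ⊗[ℝ] TangentSpace 𝓘(ℝ, E) x) :
    Hrep →ₗ[ℂ] ℂ ⊗[ℝ] TangentSpace 𝓘(ℝ, E) x where
  toFun h := h 0 • v + h 1 • complexJ J 1 v
  map_add' h k := by simp only [PiLp.add_apply, add_smul]; abel
  map_smul' c h := by simp only [PiLp.smul_apply, smul_eq_mul, mul_smul, smul_add,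
    RingHom.id_apply]

/-- As `j` of index 1 sends `hb 0` to `hb 1`, the image of `hb 1` must be `J 1` applied to `v`. The
eigenvalue condition on `v` gives the intertwining for index 0, and the quaternionic relations then
give index 2. -/
lemma IsAdmissibleBasis.efibreOf_mem (hJ : IsAdmissibleBasis Qx J)
    {v : ℂ ⊗[ℝ] TangentSpace 𝓘(ℝ, E) x} (hv : complexJ J 0 v = Complex.I • v) :
    efibreOf J v ∈ Efibre J := by
  have h01 := complexJ_comp J hJ.mul_zero_one
  have h20 := complexJ_comp J hJ.mul_two_zero
  have h2v : complexJ J 2 v = -(Complex.I • complexJ J 1 v) := by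
    rw [← h20 v, hv, map_smul, smul_smul, Complex.I_mul_I, neg_one_smul, neg_neg]
  have h0 : complexJ J 0 (complexJ J 1 v) = -(Complex.I • complexJ J 1 v) := by rw [h01, h2v]
  have h2 : complexJ J 2 (complexJ J 1 v) = -(Complex.I • v) := by
    rw [← h20, complexJ_comp J hJ.mul_two_zero, ← h01, hJ.complexJ_sq, map_neg, hv]
  intro i h
  change efibreOf J v _ = complexJ J i (h 0 • v + h 1 • complexJ J 1 v)
  rw [map_add, map_smul, map_smul]
  obtain ⟨a0, a1, a2⟩ := act_sp1 h
  fin_cases i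
  · simp only [Fin.zero_eta, a0, efibreOf, hv, h0]
    simp [hb]
    module
  · simp only [Fin.mk_one, a1, efibreOf, hJ.complexJ_sq]
    simp [hb]
    module
  · simp only [Fin.reduceFinMk, a2, efibreOf, h2, h2v]
    simp [hb]
    module

/-- The orthogonal projection to `S³(H)` vanishes exactly on the orthogonal of `S³(H)`, whose
equations are known. -/
lemma penroseProj_apply_eq_zero_iff (γ : TangentSpace 𝓘(ℝ, E) x →L[ℝ] EndT E x) (e : Efibre J) :
    penroseProj J γ e = 0 ↔
      complexCoord J γ 1 (e.1 (hb 0)) = Complex.I * complexCoord J γ 2 (e.1 (hb 0)) ∧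
      complexCoord J γ 0 (e.1 (hb 1)) = complexCoord J γ 2 (e.1 (hb 0)) ∧
      complexCoord J γ 1 (e.1 (hb 1)) = Complex.I * complexCoord J γ 0 (e.1 (hb 0)) ∧
      complexCoord J γ 2 (e.1 (hb 1)) = -complexCoord J γ 0 (e.1 (hb 0)) := by
  rw [← raise_mem_S3_orthogonal_iff
    (((toS2 J ∘ₗ γ.toLinearMap).liftBaseChange ℂ) ∘ₗ e.1)
    (fun i ↦ complexCoord J γ i (e.1 (hb 0))) (fun i ↦ complexCoord J γ i (e.1 (hb 1)))
    (liftBaseChange_toS2 J γ _) (liftBaseChange_toS2 J γ _)]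
  have h : penroseProj J γ e = S3.orthogonalProjectionOnto
      (raise (((toS2 J ∘ₗ γ.toLinearMap).liftBaseChange ℂ) ∘ₗ e.1)) := rfl
  rw [h]
  exact Submodule.orthogonalProjectionOnto_eq_zero_iff (K := S3)

/-- The projection of `γ ∈ T_x^*M ⊗ Q_x` to `𝐄^* ⊗ S³(𝐇)` vanishes if and only if the `1`-forms
`⟨γ, J_i⟩ ∘ J_i` coincide. -/
theorem penroseProj_eq_zero_iff (hJ : IsAdmissibleBasis Qx J)
    (γ : TangentSpace 𝓘(ℝ, E) x →L[ℝ] EndT E x) :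
    penroseProj J γ = 0 ↔
    ∀ X, metricQ (γ (J 0 X)) (J 0) = metricQ (γ (J 1 X)) (J 1) ∧
      metricQ (γ (J 1 X)) (J 1) = metricQ (γ (J 2 X)) (J 2) := by
  have hI : Complex.I * Complex.I = -1 := Complex.I_mul_I
  have hb0 : act (sp1 0) (hb 0) = Complex.I • hb 0 ∧ act (sp1 1) (hb 0) = hb 1 ∧
      act (sp1 2) (hb 0) = -(Complex.I • hb 1) := by
    obtain ⟨a0, a1, a2⟩ := act_sp1 (hb 0)
    rw [a0, a1, a2]; simp [hb]
  have hb1 : act (sp1 0) (hb 1) = -(Complex.I • hb 1) ∧ act (sp1 1) (hb 1) = -hb 0 ∧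
      act (sp1 2) (hb 1) = -(Complex.I • hb 0) := by
    obtain ⟨a0, a1, a2⟩ := act_sp1 (hb 1)
    rw [a0, a1, a2]; simp [hb]
  constructor
  · intro H X
    -- Twice the component of `X` in the `i`-eigenspace of `J 0`, so that `v` defines an element of
    -- `𝐄`.
    set v : ℂ ⊗[ℝ] TangentSpace 𝓘(ℝ, E) x := 1 ⊗ₜ X - Complex.I ⊗ₜ (J 0 X) with hv
    have hJX : J 0 (J 0 X) = -X := DFunLike.congr_fun (hJ.sq 0) X
    have hv0 : complexJ J 0 v = Complex.I • v := by
      simp only [hv, complexJ, map_sub, LinearMap.baseChange_tmul, smul_sub,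
        TensorProduct.smul_tmul', smul_eq_mul, hI, mul_one]
      have : (J 0).toLinearMap (J 0 X) = -X := hJX
      rw [this, TensorProduct.tmul_neg, TensorProduct.neg_tmul]
      change 1 ⊗ₜ[ℝ] (J 0 X) - _ = _
      abel
    obtain ⟨-, -, e1, e2⟩ := (penroseProj_apply_eq_zero_iff γ
      (⟨efibreOf J v, hJ.efibreOf_mem hv0⟩ : Efibre J)).1 (by rw [H]; rfl)
    have f0 : efibreOf J v (hb 0) = v := by simp [efibreOf, hb]
    have f1 : efibreOf J v (hb 1) = complexJ J 1 v := by simp [efibreOf, hb]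
    simp only [f0, f1] at e1 e2
    have h2v : complexJ J 2 v = -(Complex.I • complexJ J 1 v) := by
      rw [← complexJ_comp J hJ.mul_two_zero v, hv0, map_smul, smul_smul, hI, neg_one_smul, neg_neg]
    have g0 : complexCoord J γ 0 (complexJ J 0 v) = Complex.I * complexCoord J γ 0 v := by
      rw [hv0, map_smul, smul_eq_mul]
    have g2 : complexCoord J γ 2 (complexJ J 2 v) = Complex.I * complexCoord J γ 0 v := by
      rw [h2v, map_neg, map_smul, smul_eq_mul, e2]; ring
    -- The coordinate forms are real on real vectors, so the real part retains only the contribution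
    -- of `1 ⊗ X` to `v`.
    have hre (i : Fin 3) :
        (complexCoord J γ i (complexJ J i v)).re = metricQ (γ (J i X)) (J i) := by
      simp only [hv, complexJ, map_sub, LinearMap.baseChange_tmul, complexCoord_tmul]
      simp
    rw [← hre 0, ← hre 1, ← hre 2, g0, e1, g2]
    exact ⟨rfl, rfl⟩
  · intro H
    have hc1 (v : ℂ ⊗[ℝ] TangentSpace 𝓘(ℝ, E) x) :
        complexCoord J γ 0 (complexJ J 0 v) = complexCoord J γ 1 (complexJ J 1 v) := by
      induction v using TensorProduct.induction_on with
      | zero => simp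
      | add v w hv hw => simp only [map_add, hv, hw]
      | tmul c X =>
        simp only [complexJ, LinearMap.baseChange_tmul, complexCoord_tmul]
        exact congrArg (fun r : ℝ ↦ c * (r : ℂ)) (H X).1
    have hc2 (v : ℂ ⊗[ℝ] TangentSpace 𝓘(ℝ, E) x) :
        complexCoord J γ 1 (complexJ J 1 v) = complexCoord J γ 2 (complexJ J 2 v) := by
      induction v using TensorProduct.induction_on with
      | zero => simp
      | add v w hv hw => simp only [map_add, hv, hw]
      | tmul c X =>
        simp only [complexJ, LinearMap.baseChange_tmul, complexCoord_tmul]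
        exact congrArg (fun r : ℝ ↦ c * (r : ℂ)) (H X).2
    refine LinearMap.ext fun e ↦ ?_
    refine (penroseProj_apply_eq_zero_iff γ e).2 ?_
    -- The intertwining property turns the equalities of the forms at `e(hb 0)` and `e(hb 1)` into
    -- linear relations between the values of the coordinates there.
    have k (i : Fin 3) (h : Hrep) : complexJ J i (e.1 h) = e.1 (act (sp1 i) h) := (e.2 i h).symm
    have p := hc1 (e.1 (hb 0))
    have q := hc2 (e.1 (hb 0))
    have p' := hc1 (e.1 (hb 1))
    have q' := hc2 (e.1 (hb 1))
    simp only [k, hb0, hb1, map_neg, map_smul, smul_eq_mul] at p q p' q'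
    refine ⟨by linear_combination -q', ?_, by linear_combination -p, ?_⟩
    · linear_combination (Complex.I) * (p' + q') + (complexCoord J γ 0 (e.1 (hb 1)) -
        complexCoord J γ 2 (e.1 (hb 0))) * hI
    · linear_combination (-Complex.I) * (p + q) + (complexCoord J γ 2 (e.1 (hb 1)) +
        complexCoord J γ 0 (e.1 (hb 0))) * hI

end PenroseProjection

/-! ### The preferred trivializations of `TM` and `End(TM)`. -/

section Coordinates

variable {E : Type*} [NormedAddCommGroup E] [NormedSpace ℝ E]
  {M : Type*} [TopologicalSpace M] [ChartedSpace E M] [IsManifold 𝓘(ℝ, E) ∞ M]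

/-- The linear map `T_y M → E` given by the preferred trivialization of `TM` at `p`. -/
def tanCoord (p y : M) : TangentSpace 𝓘(ℝ, E) y →L[ℝ] E :=
  (trivializationAt E (TangentSpace 𝓘(ℝ, E) : M → Type _) p).continuousLinearMapAt ℝ y

/-- The inverse `E → T_y M` of the preferred trivialization of `TM` at `p`. -/
def tanCoordSymm (p y : M) : E →L[ℝ] TangentSpace 𝓘(ℝ, E) y :=
  (trivializationAt E (TangentSpace 𝓘(ℝ, E) : M → Type _) p).symmL ℝ y

/-- The fibre coordinate on `End(TM)` given by the preferred trivialization at `p`. -/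
def coord (p : M) (w : EndBundle E M) : E →L[ℝ] E :=
  (trivializationAt (E →L[ℝ] E) (EndT E : M → Type _) p w).2

lemma coord_eq (p : M) (w : EndBundle E M) :
    coord p w = tanCoord p w.proj ∘L w.2 ∘L tanCoordSymm p w.proj := rfl

variable (E) in
/-- The domain of the preferred trivializations at `p`. -/
abbrev coordSource (p : M) : Set M := (chartAt E p).source

set_option linter.unusedSectionVars false in
lemma coordSource_mem_nhds (p : M) : coordSource E p ∈ 𝓝 p := chart_source_mem_nhds E p

lemma eventually_mem_coordSource (p : M) : ∀ᶠ y in 𝓝 p, y ∈ coordSource E p :=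
  coordSource_mem_nhds p

lemma tanCoord_tanCoordSymm {p y : M} (hy : y ∈ coordSource E p) (v : E) :
    tanCoord p y (tanCoordSymm p y v) = v :=
  Trivialization.continuousLinearMapAt_symmL _ (by simpa using hy) v

lemma tanCoordSymm_tanCoord {p y : M} (hy : y ∈ coordSource E p) (v : TangentSpace 𝓘(ℝ, E) y) :
    tanCoordSymm p y (tanCoord p y v) = v :=
  Trivialization.symmL_continuousLinearMapAt _ (by simpa using hy) v

/-- The tangent space at `p` is by definition the model space read in the preferred chart at `p`, so
the coordinate change is trivial. For this reason tangent vectors and endomorphisms at `p` may be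
treated as elements of `E` and `E →L[ℝ] E`. -/
lemma tanCoord_self (p : M) (v : TangentSpace 𝓘(ℝ, E) p) : tanCoord p p v = v := by
  unfold tanCoord
  rw [TangentBundle.continuousLinearMapAt_trivializationAt_eq_core (mem_chart_source E p)]
  exact (tangentBundleCore 𝓘(ℝ, E) M).coordChange_self (achart E p) p (mem_chart_source E p) v

lemma tanCoordSymm_self (p : M) (v : E) : tanCoordSymm p p v = v := by
  exact (congrArg (tanCoordSymm p p) (tanCoord_self p v)).symm.trans
    (tanCoordSymm_tanCoord (mem_chart_source E p) (v : TangentSpace 𝓘(ℝ, E) p))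

lemma coord_self (p : M) (T : EndT E p) : coord p ⟨p, T⟩ = T := by
  rw [coord_eq]
  ext v
  exact (tanCoord_self p _).trans (congrArg T (tanCoordSymm_self p v))

lemma coord_add (p y : M) (S T : EndT E y) :
    coord p ⟨y, S + T⟩ = coord p ⟨y, S⟩ + coord p ⟨y, T⟩ := by
  ext v
  simp [coord_eq]

lemma coord_smul (p y : M) (c : ℝ) (T : EndT E y) :
    coord p ⟨y, c • T⟩ = c • coord p ⟨y, T⟩ := by
  ext v
  simp [coord_eq]

lemma coord_neg (p y : M) (T : EndT E y) : coord p ⟨y, -T⟩ = -coord p ⟨y, T⟩ := by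
  ext v
  simp [coord_eq]

lemma coord_sum (p y : M) (T : Fin 3 → EndT E y) :
    coord p ⟨y, ∑ i, T i⟩ = ∑ i, coord p ⟨y, T i⟩ := by
  simp only [Fin.sum_univ_three, coord_add]

lemma coord_comp {p y : M} (hy : y ∈ coordSource E p) (S T : EndT E y) :
    coord p ⟨y, S ∘L T⟩ = coord p ⟨y, S⟩ * coord p ⟨y, T⟩ := by
  ext v
  simp [coord_eq, tanCoordSymm_tanCoord hy]

lemma coord_id {p y : M} (hy : y ∈ coordSource E p) :
    coord p ⟨y, ContinuousLinearMap.id ℝ (TangentSpace 𝓘(ℝ, E) y)⟩ = 1 := by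
  ext v
  simp [coord_eq, tanCoord_tanCoordSymm hy]

lemma coord_apply_tanCoord {p y : M} (hy : y ∈ coordSource E p) (T : EndT E y)
    (v : TangentSpace 𝓘(ℝ, E) y) : coord p ⟨y, T⟩ (tanCoord p y v) = tanCoord p y (T v) := by
  simp [coord_eq, tanCoordSymm_tanCoord hy]

lemma mem_baseSet_end {p y : M} (hy : y ∈ coordSource E p) :
    y ∈ (trivializationAt (E →L[ℝ] E) (EndT E : M → Type _) p).baseSet := by
  simpa [hom_trivializationAt] using! hy

/-- The section `extend` is constant in the trivialization at `p`. Its flat derivative at `p` is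
therefore zero, and only the connection form contributes to its covariant derivative. -/
lemma coord_extend {p y : M} (hy : y ∈ coordSource E p) (T : EndT E p) :
    coord p ⟨y, extend (E →L[ℝ] E) T y⟩ = T := by
  unfold coord extend
  rw [Trivialization.apply_mk_symm _ (mem_baseSet_end hy)]
  exact coord_self p T

lemma symmL_end_self (p : M) (T : E →L[ℝ] E) :
    (trivializationAt (E →L[ℝ] E) (EndT E : M → Type _) p).symmL ℝ p T = T := by
  have h := Trivialization.symmL_continuousLinearMapAt (R := ℝ)
    (trivializationAt (E →L[ℝ] E) (EndT E : M → Type _) p)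
    (mem_baseSet_end (mem_chart_source E p)) (T : EndT E p)
  rw [Trivialization.continuousLinearMapAt_apply, Trivialization.coe_linearMapAt_of_mem _
    (mem_baseSet_end (mem_chart_source E p))] at h
  exact (congrArg _ (coord_self p T)).symm.trans h

lemma tanCoord_extend {p y : M} (hy : y ∈ coordSource E p) (v : TangentSpace 𝓘(ℝ, E) p) :
    tanCoord p y (extend E v y) = v := by
  unfold extend
  have h : (trivializationAt E (TangentSpace 𝓘(ℝ, E) : M → Type _) p ⟨p, v⟩).2 = v := by
    have := tanCoord_self p v
    rwa [tanCoord, Trivialization.continuousLinearMapAt_apply,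
      Trivialization.coe_linearMapAt_of_mem _ (by simp)] at this
  rw [h]
  have h' := Trivialization.symmL_apply (R := ℝ)
    (trivializationAt E (TangentSpace 𝓘(ℝ, E) : M → Type _) p) (b := y) (by simpa using hy) v
  exact (congrArg (tanCoord p y) h').symm.trans (tanCoord_tanCoordSymm hy v)

/-! ### Differentiability in terms of coordinates -/

lemma mdifferentiableAt_secMap_iff {A : Π x : M, EndT E x} {p : M} :
    MDifferentiableAt 𝓘(ℝ, E) (endModel E) (secMap A) p ↔
      MDifferentiableAt 𝓘(ℝ, E) 𝓘(ℝ, E →L[ℝ] E) (fun y ↦ coord p (secMap A y)) p :=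
  mdifferentiableAt_section 𝓘(ℝ, E) A

lemma mdifferentiableAt_tanCoord {Y : Π x : M, TangentSpace 𝓘(ℝ, E) x} {p : M}
    (hY : MDiffAt (T% Y) p) :
    MDifferentiableAt 𝓘(ℝ, E) 𝓘(ℝ, E) (fun y ↦ tanCoord p y (Y y)) p := by
  refine ((mdifferentiableAt_section 𝓘(ℝ, E) Y).1 hY).congr_of_eventuallyEq ?_
  filter_upwards [eventually_mem_coordSource (E := E) p] with y hy
  rw [tanCoord, Trivialization.continuousLinearMapAt_apply,
    Trivialization.coe_linearMapAt_of_mem _ (by simpa using hy)]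

lemma contMDiffAt_coord (z : EndBundle E M) :
    ContMDiffAt (endModel E) 𝓘(ℝ, E →L[ℝ] E) ∞ (coord z.proj) z :=
  (contMDiffAt_totalSpace.1 (contMDiffAt_id (I := endModel E) (x := z))).2

lemma mdifferentiableAt_coord (z : EndBundle E M) :
    MDifferentiableAt (endModel E) 𝓘(ℝ, E →L[ℝ] E) (coord z.proj) z :=
  (contMDiffAt_coord z).mdifferentiableAt (by simp)

/-- The differential of the preferred trivialization at `z` is the identity in the preferred
charts. -/
lemma hasMFDerivAt_trivializationAt (z : EndBundle E M) :
    HasMFDerivAt (endModel E) (endModel E)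
      (trivializationAt (E →L[ℝ] E) (EndT E : M → Type _) z.proj : EndBundle E M → _) z
      (ContinuousLinearMap.id ℝ (E × (E →L[ℝ] E))) := by
  refine ⟨?_, ?_⟩
  · exact (trivializationAt (E →L[ℝ] E) (EndT E : M → Type _) z.proj).continuousAt
      (by simp)
  · refine (hasFDerivWithinAt_id _ _).congr_of_eventuallyEq ?_ ?_
    · filter_upwards [extChartAt_target_mem_nhdsWithin (I := endModel E) z] with y hy
      exact FiberBundle.writtenInExtChartAt_trivializationAt hy
    · exact FiberBundle.writtenInExtChartAt_trivializationAt (mem_extChartAt_target z)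

/-- With `mvfderiv_coord`, this identifies a tangent vector of `End(TM)` at `z` with the pair of its
base and fibre components. -/
lemma projDeriv_eq (z : EndBundle E M) (U : TangentSpace (endModel E) z) :
    projDeriv z U = (U : E × (E →L[ℝ] E)).1 := by
  have h := (hasMFDerivAt_fst (I := 𝓘(ℝ, E)) (I' := 𝓘(ℝ, E →L[ℝ] E)) _).comp z
    (hasMFDerivAt_trivializationAt z)
  have h1 : (TotalSpace.proj : EndBundle E M → M) =ᶠ[𝓝 z] Prod.fst ∘
      (trivializationAt (E →L[ℝ] E) (EndT E : M → Type _) z.proj : EndBundle E M → _) := by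
    have : ∀ᶠ w in 𝓝 z, w ∈ (trivializationAt (E →L[ℝ] E) (EndT E : M → Type _) z.proj).source :=
      (trivializationAt (E →L[ℝ] E) (EndT E : M → Type _) z.proj).open_source.mem_nhds (by simp)
    filter_upwards [this] with w hw
    exact (Trivialization.coe_fst _ hw).symm
  exact DFunLike.congr_fun ((h.congr_of_eventuallyEq h1).mfderiv) U

lemma mvfderiv_coord (z : EndBundle E M) (U : TangentSpace (endModel E) z) :
    mvfderiv (endModel E) (coord z.proj) z U = (U : E × (E →L[ℝ] E)).2 := by
  have h := (hasMFDerivAt_snd (I := 𝓘(ℝ, E)) (I' := 𝓘(ℝ, E →L[ℝ] E)) _).comp z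
    (hasMFDerivAt_trivializationAt z)
  have h' := h.mfderiv
  exact DFunLike.congr_fun h' U

end Coordinates

/-! ### Differentiation rules for vector-valued functions on manifolds. -/

section Calculus

variable {F : Type*} [NormedAddCommGroup F] [NormedSpace ℝ F] {H : Type*} [TopologicalSpace H]
  {I : ModelWithCorners ℝ F H} {N : Type*} [TopologicalSpace N] [ChartedSpace H N]
  {G G' : Type*} [NormedAddCommGroup G] [NormedSpace ℝ G] [NormedAddCommGroup G'] [NormedSpace ℝ G']
  {x : N}

lemma mvfderiv_congr {f g : N → G} (h : f =ᶠ[𝓝 x] g) (X : TangentSpace I x) :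
    mvfderiv I f x X = mvfderiv I g x X :=
  DFunLike.congr_fun (h.mfderiv_eq (I := I) (I' := 𝓘(ℝ, G))) X

lemma mvfderiv_clm_comp (L : G →L[ℝ] G') {f : N → G} (hf : MDifferentiableAt I 𝓘(ℝ, G) f x)
    (X : TangentSpace I x) : mvfderiv I (fun y ↦ L (f y)) x X = L (mvfderiv I f x X) :=
  DFunLike.congr_fun ((L.hasMFDerivAt (x := f x)).comp x hf.hasMFDerivAt).mfderiv X

lemma mvfderiv_mul_ring {R : Type*} [NormedRing R] [NormedAlgebra ℝ R] {f g : N → R}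
    (hf : MDifferentiableAt I 𝓘(ℝ, R) f x) (hg : MDifferentiableAt I 𝓘(ℝ, R) g x)
    (X : TangentSpace I x) :
    mvfderiv I (fun y ↦ f y * g y) x X = f x * mvfderiv I g x X + mvfderiv I f x X * g x :=
  DFunLike.congr_fun (hf.hasMFDerivAt.mul' hg.hasMFDerivAt).mfderiv X

end Calculus

/-! ### The connection form, and `D` on vector fields and endomorphisms in coordinates. -/

section Connection

variable {E : Type*} [NormedAddCommGroup E] [NormedSpace ℝ E]
  {M : Type*} [TopologicalSpace M] [ChartedSpace E M] [IsManifold 𝓘(ℝ, E) ∞ M]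

/-- A tangent vector at `p`, as an element of the model space. -/
def toModel {p : M} (v : TangentSpace 𝓘(ℝ, E) p) : E := v

/-- An endomorphism of `T_p M`, as an endomorphism of the model space. -/
def toEnd {p : M} (T : EndT E p) : E →L[ℝ] E := T

/-- The difference between `D` and the flat connection defined by the preferred trivialization at
`p` is tensorial at `p`. -/
lemma tensorialAt_sub_flat
    (D : CovariantDerivative 𝓘(ℝ, E) E (TangentSpace 𝓘(ℝ, E) : M → Type _)) (p : M) :
    TensorialAt 𝓘(ℝ, E) E (A := E →L[ℝ] E) (fun Y : Π x : M, TangentSpace 𝓘(ℝ, E) x ↦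
      toEnd (D Y p) - toEnd (mvfderiv 𝓘(ℝ, E) (fun y ↦ tanCoord p y (Y y)) p)) p where
  smul := by
    intro f Y hf hY
    have h1 : (fun y ↦ tanCoord p y ((f • Y) y)) = f • (fun y ↦ tanCoord p y (Y y)) := by
      funext y; simp
    have h2 : toEnd (D (f • Y) p) = f p • toEnd (D Y p) +
        toEnd ((mvfderiv 𝓘(ℝ, E) f p).smulRight (Y p)) :=
      D.isCovariantDerivativeOnUniv.leibniz hY hf
    have h3 : toEnd (mvfderiv 𝓘(ℝ, E) (f • (fun y ↦ tanCoord p y (Y y))) p) =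
        f p • toEnd (mvfderiv 𝓘(ℝ, E) (fun y ↦ tanCoord p y (Y y)) p) +
        toEnd ((mvfderiv 𝓘(ℝ, E) f p).smulRight (Y p)) := by
      have h4 := mvfderiv_smul hf (mdifferentiableAt_tanCoord hY)
      rw [tanCoord_self] at h4
      exact h4
    rw [h1, h2, h3, smul_sub]
    abel
  add := by
    intro Y Y' hY hY'
    have h1 : (fun y ↦ tanCoord p y ((Y + Y') y)) =
        (fun y ↦ tanCoord p y (Y y)) + (fun y ↦ tanCoord p y (Y' y)) := by
      funext y; simp
    have h2 : toEnd (D (Y + Y') p) = toEnd (D Y p) + toEnd (D Y' p) :=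
      D.isCovariantDerivativeOnUniv.add hY hY'
    have h3 : toEnd (mvfderiv 𝓘(ℝ, E) ((fun y ↦ tanCoord p y (Y y)) +
        (fun y ↦ tanCoord p y (Y' y))) p) =
        toEnd (mvfderiv 𝓘(ℝ, E) (fun y ↦ tanCoord p y (Y y)) p) +
        toEnd (mvfderiv 𝓘(ℝ, E) (fun y ↦ tanCoord p y (Y' y)) p) :=
      mvfderiv_add (mdifferentiableAt_tanCoord hY) (mdifferentiableAt_tanCoord hY')
    rw [h1, h2, h3]
    abel

variable [FiniteDimensional ℝ E]

/-- The connection form of `D` at `p`, with respect to the preferred trivialization at `p`. -/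
def connForm (D : CovariantDerivative 𝓘(ℝ, E) E (TangentSpace 𝓘(ℝ, E) : M → Type _)) (p : M) :
    E →L[ℝ] E →L[ℝ] E :=
  ContinuousLinearMap.flip (E := E) (F := E) (G := E)
    (TensorialAt.mkHom _ p (tensorialAt_sub_flat D p))

variable (D : CovariantDerivative 𝓘(ℝ, E) E (TangentSpace 𝓘(ℝ, E) : M → Type _))

lemma covariantDerivative_eq {p : M} {Y : Π x : M, TangentSpace 𝓘(ℝ, E) x}
    (hY : MDiffAt (T% Y) p) (X : TangentSpace 𝓘(ℝ, E) p) :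
    toModel (D Y p X) =
      mvfderiv 𝓘(ℝ, E) (fun y ↦ tanCoord p y (Y y)) p X + connForm D p X (Y p) := by
  have h := congrArg (fun L : E →L[ℝ] E ↦ L X)
    (TensorialAt.mkHom_apply (tensorialAt_sub_flat D p) hY)
  have h2 : connForm D p X (Y p) = toModel (D Y p X) -
    mvfderiv 𝓘(ℝ, E) (fun y ↦ tanCoord p y (Y y)) p X := h
  rw [h2, add_sub_cancel]

lemma covariantDerivative_extend {p : M} (v X : TangentSpace 𝓘(ℝ, E) p) :
    toModel (D (extend E v) p X) = connForm D p X v := by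
  have h : (fun y ↦ tanCoord p y (extend E v y)) =ᶠ[𝓝 p] fun _ ↦ toModel v := by
    filter_upwards [eventually_mem_coordSource (E := E) p] with y hy
    exact tanCoord_extend hy v
  rw [covariantDerivative_eq D (mdifferentiableAt_extend 𝓘(ℝ, E) E v) X, extend_apply_self,
    mvfderiv_congr h, mvfderiv_const]
  exact zero_add _

/-- The induced connection on `End(TM)` in coordinates. -/
theorem endCov_eq {A : Π x : M, EndT E x} {p : M}
    (hA : MDifferentiableAt 𝓘(ℝ, E) (endModel E) (secMap A) p) (X : TangentSpace 𝓘(ℝ, E) p) :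
    toEnd (endCov D A p X) = mvfderiv 𝓘(ℝ, E) (fun y ↦ coord p (secMap A y)) p X +
      (connForm D p X * toEnd (A p) - toEnd (A p) * connForm D p X) := by
  refine ContinuousLinearMap.ext fun v ↦ ?_
  let w : TangentSpace 𝓘(ℝ, E) p := v
  have hY := mdifferentiableAt_extend 𝓘(ℝ, E) E w
  have hAY : MDiffAt (T% (fun y ↦ A y (extend E w y))) p :=
    hA.clm_bundle_apply hY
  have h := endCov_apply D A p hA _ hY X
  rw [extend_apply_self] at h
  -- The extension of `v` is constant in coordinates, so differentiating `A` applied to it only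
  -- differentiates the matrix of `A`; the connection form then enters once from the left and once
  -- from the right.
  have h1 : (fun y ↦ tanCoord p y (A y (extend E w y))) =ᶠ[𝓝 p]
      fun y ↦ coord p (secMap A y) v := by
    filter_upwards [eventually_mem_coordSource (E := E) p] with y hy
    have h3 := coord_apply_tanCoord hy (A y) (extend E w y)
    exact h3.symm.trans (congrArg (coord p (secMap A y)) (tanCoord_extend hy _))
  have h2 := covariantDerivative_eq D hAY X
  have h4 : mvfderiv 𝓘(ℝ, E) (fun y ↦ coord p (secMap A y) v) p X =
      mvfderiv 𝓘(ℝ, E) (fun y ↦ coord p (secMap A y)) p X v :=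
    mvfderiv_clm_comp (ContinuousLinearMap.apply ℝ E v) (mdifferentiableAt_secMap_iff.1 hA) X
  rw [mvfderiv_congr h1, h4, extend_apply_self] at h2
  have h5 : toModel (endCov D A p X w) = toModel (D (fun y ↦ A y (extend E w y)) p X) -
      toEnd (A p) (toModel (D (extend E w) p X)) := h
  have h6 := covariantDerivative_extend D w X
  refine h5.trans ?_
  rw [h2, h6]
  exact add_sub_assoc ..

end Connection

/-! ### Horizontal and vertical lifts and `𝒥` in coordinates. -/

section Lifts

variable {E : Type*} [NormedAddCommGroup E] [NormedSpace ℝ E]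
  {M : Type*} [TopologicalSpace M] [ChartedSpace E M] [IsManifold 𝓘(ℝ, E) ∞ M]

/-- A tangent vector of the total space of `End(TM)`, as an element of the model space. -/
def toProd {z : EndBundle E M} (U : TangentSpace (endModel E) z) : E × (E →L[ℝ] E) := U

lemma mdifferentiableAt_secMap_extend {p : M} (T : EndT E p) :
    MDifferentiableAt 𝓘(ℝ, E) (endModel E) (secMap (extend (E →L[ℝ] E) T)) p :=
  mdifferentiableAt_extend 𝓘(ℝ, E) (E →L[ℝ] E) T

lemma mvfderiv_coord_secMap_extend {p : M} (T : EndT E p) (X : TangentSpace 𝓘(ℝ, E) p) :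
    mvfderiv 𝓘(ℝ, E) (fun y ↦ coord p (secMap (extend (E →L[ℝ] E) T) y)) p X = 0 := by
  have h : (fun y ↦ coord p (secMap (extend (E →L[ℝ] E) T) y)) =ᶠ[𝓝 p] fun _ ↦ toEnd T := by
    filter_upwards [eventually_mem_coordSource (E := E) p] with y hy
    exact coord_extend hy T
  rw [mvfderiv_congr h, mvfderiv_const]
  rfl

section Maps

variable {F : Type*} [NormedAddCommGroup F] [NormedSpace ℝ F] {H : Type*} [TopologicalSpace H]
  {I : ModelWithCorners ℝ F H} {N : Type*} [TopologicalSpace N] [ChartedSpace H N]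

/-- The differential of a map to the total space of `End(TM)`, in coordinates. -/
lemma mfderiv_endBundle {f : N → EndBundle E M} {x : N} {z : EndBundle E M} (hz : f x = z)
    (hf : MDifferentiableAt I (endModel E) f x) (X : TangentSpace I x) :
    toProd (mfderiv I (endModel E) f x X) =
      ((mfderiv I 𝓘(ℝ, E) (fun y ↦ (f y).proj) x X : E),
        mvfderiv I (fun y ↦ coord z.proj (f y)) x X) := by
  subst hz
  refine Prod.ext ?_ ?_
  · refine (projDeriv_eq (f x) (mfderiv I (endModel E) f x X)).symm.trans ?_
    exact (DFunLike.congr_fun (mfderiv_comp x (mdifferentiableAt_proj (EndT E : M → Type _)) hf)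
      X).symm
  · refine (mvfderiv_coord (f x) (mfderiv I (endModel E) f x X)).symm.trans ?_
    exact (DFunLike.congr_fun (mfderiv_comp x (mdifferentiableAt_coord (f x)) hf) X).symm

end Maps

lemma sectionLift_eq (z : EndBundle E M) (X : TangentSpace 𝓘(ℝ, E) z.proj) :
    toProd (sectionLift z X) = (toModel X, 0) := by
  have hz : secMap (extend (E →L[ℝ] E) z.2) z.proj = z := by
    unfold secMap; rw [extend_apply_self]
  have h := mfderiv_endBundle hz (mdifferentiableAt_secMap_extend z.2) X
  refine h.trans (Prod.ext ?_ ?_)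
  · exact DFunLike.congr_fun (mfderiv_id (I := 𝓘(ℝ, E)) (x := z.proj)) X
  · exact mvfderiv_coord_secMap_extend z.2 X

lemma verticalLift_eq (z : EndBundle E M) (B : EndT E z.proj) :
    toProd (verticalLift z B) = (0, toEnd B) := by
  have hc : (fun t : ℝ ↦ coord z.proj (⟨z.proj, z.2 + t • B⟩ : EndBundle E M)) =
      fun t : ℝ ↦ toEnd z.2 + t • toEnd B := by
    funext t; exact coord_self _ _
  have hd : HasMFDerivAt 𝓘(ℝ, ℝ) 𝓘(ℝ, E →L[ℝ] E) (fun t : ℝ ↦ toEnd z.2 + t • toEnd B) 0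
      ((1 : ℝ →L[ℝ] ℝ).smulRight (toEnd B)) := by
    refine HasFDerivAt.hasMFDerivAt ?_
    exact ((hasFDerivAt_id (𝕜 := ℝ) (0 : ℝ)).smul_const (toEnd B)).const_add _
  have hz : (⟨z.proj, z.2 + (0 : ℝ) • B⟩ : EndBundle E M) = z := by simp
  have hm : MDifferentiableAt 𝓘(ℝ, ℝ) (endModel E)
      (fun t : ℝ ↦ (⟨z.proj, z.2 + t • B⟩ : EndBundle E M)) 0 := by
    rw [mdifferentiableAt_totalSpace]
    refine ⟨mdifferentiableAt_const, ?_⟩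
    exact hc ▸ hd.mdifferentiableAt
  have h := mfderiv_endBundle
    (f := fun t : ℝ ↦ (⟨z.proj, z.2 + t • B⟩ : EndBundle E M)) hz hm (1 : ℝ)
  refine h.trans (Prod.ext ?_ ?_)
  · exact DFunLike.congr_fun (mfderiv_const (I := 𝓘(ℝ, ℝ)) (I' := 𝓘(ℝ, E)) (c := z.proj)
      (x := (0 : ℝ))) (1 : ℝ)
  · rw [hc]
    refine (DFunLike.congr_fun hd.mfderiv (1 : ℝ)).trans ?_
    exact one_smul ℝ (toEnd B)

variable [FiniteDimensional ℝ E]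
  (D : CovariantDerivative 𝓘(ℝ, E) E (TangentSpace 𝓘(ℝ, E) : M → Type _))

lemma endCov_extend {p : M} (T : EndT E p) (X : TangentSpace 𝓘(ℝ, E) p) :
    toEnd (endCov D (extend (E →L[ℝ] E) T) p X) =
      connForm D p X * toEnd T - toEnd T * connForm D p X := by
  rw [endCov_eq D (mdifferentiableAt_secMap_extend T), mvfderiv_coord_secMap_extend, zero_add,
    extend_apply_self]

lemma pullbackCov_eq (S : Set (EndBundle E M)) (s : Π z : EndBundle E M, EndT E z.proj)
    (z : EndBundle E M) (U : TangentSpace (endModel E) z) :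
    toEnd (pullbackCov D S s z U) =
      mvfderivWithin (endModel E) (fun w ↦ coord z.proj ⟨w.proj, s w⟩) S z U +
      (connForm D z.proj (toProd U).1 * toEnd (s z) -
        toEnd (s z) * connForm D z.proj (toProd U).1) := by
  have h : toEnd (endCov D (extend (E →L[ℝ] E) (s z)) z.proj (projDeriv z U)) =
      connForm D z.proj (toProd U).1 * toEnd (s z) -
        toEnd (s z) * connForm D z.proj (toProd U).1 := by
    rw [endCov_extend, projDeriv_eq]; rfl
  exact congr_arg₂ (fun S T : E →L[ℝ] E ↦ S + T) (symmL_end_self z.proj _) h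

/-- The derivative of the tautological section is the fibre component of `U`. The horizontal space
is the set of pairs `(X, -[Γ(X), z])`. -/
lemma verticalPart_eq (z : EndBundle E M) (U : TangentSpace (endModel E) z) :
    toEnd (verticalPart D z U) = (toProd U).2 +
      (connForm D z.proj (toProd U).1 * toEnd z.2 -
        toEnd z.2 * connForm D z.proj (toProd U).1) := by
  have h := pullbackCov_eq D Set.univ (fun w ↦ w.2) z U
  rw [mvfderivWithin_univ] at h
  refine h.trans ?_
  congr 1
  exact mvfderiv_coord z U

lemma horizontalLift_eq (z : EndBundle E M) (X : TangentSpace 𝓘(ℝ, E) z.proj) :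
    toProd (horizontalLift D z X) =
      (toModel X, -(connForm D z.proj X * toEnd z.2 - toEnd z.2 * connForm D z.proj X)) := by
  have h : toProd (horizontalLift D z X) = toProd (sectionLift z X) -
    toProd (verticalLift z (endCov D (extend (E →L[ℝ] E) z.2) z.proj X)) := rfl
  rw [h, sectionLift_eq, verticalLift_eq, endCov_extend]
  simp

lemma twistorJ_fst (z : EndBundle E M) (U : TangentSpace (endModel E) z) :
    (toProd (twistorJ D z U)).1 = toEnd z.2 (toProd U).1 := by
  have h : toProd (twistorJ D z U) = toProd (horizontalLift D z (z.2 (projDeriv z U))) +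
    toProd (verticalLift z (z.2 ∘L verticalPart D z U)) := rfl
  rw [h, horizontalLift_eq, verticalLift_eq, projDeriv_eq]
  simp
  rfl

/-- The commutator in `verticalPart` cancels the fibre component of the horizontal lift in `𝒥U`,
leaving its vertical summand. -/
lemma verticalPart_twistorJ (z : EndBundle E M) (U : TangentSpace (endModel E) z) :
    toEnd (verticalPart D z (twistorJ D z U)) = toEnd z.2 * toEnd (verticalPart D z U) := by
  have h : toProd (twistorJ D z U) = toProd (horizontalLift D z (z.2 (projDeriv z U))) +
    toProd (verticalLift z (z.2 ∘L verticalPart D z U)) := rfl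
  rw [verticalPart_eq D z (twistorJ D z U), twistorJ_fst, h, horizontalLift_eq, verticalLift_eq,
    projDeriv_eq]
  simp only [Prod.snd_add]
  have h2 : toEnd (z.2 ∘L verticalPart D z U) = toEnd z.2 * toEnd (verticalPart D z U) := rfl
  rw [h2]
  set a := toEnd z.2 * toEnd (verticalPart D z U)
  exact neg_add_cancel_comm ..

end Lifts

/-! ### Curves and their velocities. -/

section Curves

variable {G : Type*} [NormedAddCommGroup G] [NormedSpace ℝ G]

lemma hasDerivAt_mvfderiv {f : ℝ → G} {t : ℝ} (hf : MDifferentiableAt 𝓘(ℝ, ℝ) 𝓘(ℝ, G) f t) :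
    HasDerivAt f (mvfderiv 𝓘(ℝ, ℝ) f t (1 : ℝ)) t := by
  have h := (mdifferentiableAt_iff_differentiableAt.1 hf).hasDerivAt
  have h2 : mvfderiv 𝓘(ℝ, ℝ) f t (1 : ℝ) = deriv f t := by
    rw [← fderiv_apply_one_eq_deriv]
    exact DFunLike.congr_fun (mfderiv_eq_fderiv (f := f) (x := t)) (1 : ℝ)
  rwa [h2]

lemma mvfderiv_one_eq {f : ℝ → G} {t : ℝ} {f' : G} (hf : HasDerivAt f f' t) :
    mvfderiv 𝓘(ℝ, ℝ) f t (1 : ℝ) = f' := by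
  have h := hasDerivAt_mvfderiv (mdifferentiableAt_iff_differentiableAt.2 hf.differentiableAt)
  exact h.unique hf

variable {E : Type*} [NormedAddCommGroup E] [NormedSpace ℝ E]
  {M : Type*} [TopologicalSpace M] [ChartedSpace E M] [IsManifold 𝓘(ℝ, E) ∞ M]

omit [IsManifold 𝓘(ℝ, E) ∞ M] in
lemma hasDerivAt_comp_curve {g : M → G} {m : ℝ → M} {p : M} {t : ℝ} (hp : m t = p)
    (hg : MDifferentiableAt 𝓘(ℝ, E) 𝓘(ℝ, G) g p) (hm : MDifferentiableAt 𝓘(ℝ, ℝ) 𝓘(ℝ, E) m t) :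
    HasDerivAt (fun s ↦ g (m s))
      (mvfderiv 𝓘(ℝ, E) g p (mfderiv 𝓘(ℝ, ℝ) 𝓘(ℝ, E) m t (1 : ℝ) : E)) t := by
  subst hp
  have h := hasDerivAt_mvfderiv (hg.comp t hm)
  have h2 : mvfderiv 𝓘(ℝ, ℝ) (g ∘ m) t (1 : ℝ) =
    mvfderiv 𝓘(ℝ, E) g (m t) (mfderiv 𝓘(ℝ, ℝ) 𝓘(ℝ, E) m t (1 : ℝ) : E) :=
    DFunLike.congr_fun (mfderiv_comp t hg hm) (1 : ℝ)
  rw [h2] at h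
  exact h

/-- There is a smooth curve in `M` with a given velocity. -/
lemma exists_curve (p : M) (X : E) : ∃ m : ℝ → M, m 0 = p ∧
    ContMDiffAt 𝓘(ℝ, ℝ) 𝓘(ℝ, E) ∞ m 0 ∧ (mfderiv 𝓘(ℝ, ℝ) 𝓘(ℝ, E) m 0 (1 : ℝ) : E) = X := by
  -- The curve is a straight line in the chart at `p`; the differential of that chart at `p` is the
  -- identity in the identification used here.
  set a : ℝ → E := fun t ↦ extChartAt 𝓘(ℝ, E) p p + t • X with ha
  have ha0 : a 0 = extChartAt 𝓘(ℝ, E) p p := by simp [ha]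
  set m : ℝ → M := fun t ↦ (extChartAt 𝓘(ℝ, E) p).symm (a t) with hm
  have hm0 : m 0 = p := by simp [hm, ha0]
  have hac : ContDiff ℝ ∞ a := by fun_prop
  have hsmooth : ContMDiffAt 𝓘(ℝ, ℝ) 𝓘(ℝ, E) ∞ m 0 := by
    have h1 : ContMDiffAt 𝓘(ℝ, E) 𝓘(ℝ, E) ∞ (extChartAt 𝓘(ℝ, E) p).symm (a 0) := by
      rw [ha0]
      exact (contMDiffOn_extChartAt_symm p).contMDiffAt (extChartAt_target_mem_nhds p)
    exact h1.comp 0 hac.contMDiff.contMDiffAt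
  refine ⟨m, hm0, hsmooth, ?_⟩
  have hmd := hsmooth.mdifferentiableAt (by simp)
  have hd := hasDerivAt_comp_curve hm0 (mdifferentiableAt_extChartAt (mem_chart_source E p)) hmd
  have he : (fun s ↦ extChartAt 𝓘(ℝ, E) p (m s)) =ᶠ[𝓝 0] a := by
    have : ∀ᶠ s in 𝓝 (0 : ℝ), a s ∈ (extChartAt 𝓘(ℝ, E) p).target :=
      hac.continuous.continuousAt (by rw [ha0]; exact extChartAt_target_mem_nhds p)
    filter_upwards [this] with s hs
    exact (extChartAt 𝓘(ℝ, E) p).right_inv hs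
  have hX : HasDerivAt a X 0 := by
    have h := ((hasDerivAt_id (0 : ℝ)).smul_const X).const_add (extChartAt 𝓘(ℝ, E) p p)
    rwa [one_smul] at h
  have h3 := hd.unique (hX.congr_of_eventuallyEq he)
  rw [← h3]
  have h4 := tanCoord_self p (mfderiv 𝓘(ℝ, ℝ) 𝓘(ℝ, E) m 0 (1 : ℝ) : E)
  unfold tanCoord at h4
  rw [TangentBundle.continuousLinearMapAt_trivializationAt (mem_chart_source E p)] at h4
  exact h4.symm

end Curves

/-! ### Tangent vectors of `Z` have vertical part in `Θ`. -/

section TwistorTangent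

variable {E : Type*} [NormedAddCommGroup E] [NormedSpace ℝ E]
  {M : Type*} [TopologicalSpace M] [ChartedSpace E M] [IsManifold 𝓘(ℝ, E) ∞ M]

/-- The derivative within the twistor space of a differentiable function on the total space
coincides on tangent vectors of the twistor space with the derivative of the function. -/
lemma mvfderivWithin_twistorSpace {G : Type*} [NormedAddCommGroup G] [NormedSpace ℝ G]
    {Q : Π x : M, Submodule ℝ (EndT E x)} {z : EndBundle E M} {f : EndBundle E M → G}
    (hf : MDifferentiableAt (endModel E) 𝓘(ℝ, G) f z) {U : TangentSpace (endModel E) z}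
    (hU : U ∈ twistorTangent Q z) :
    mvfderivWithin (endModel E) f (twistorSpace Q) z U = mvfderiv (endModel E) f z U := by
  obtain ⟨c, hc, hcZ, rfl, rfl⟩ := hU
  have hc' := (hc.mdifferentiableAt (by simp)).hasMFDerivAt
  -- A derivative within `Z` is not unique as a linear map on the tangent space of `End(TM)`. Along
  -- a curve that stays in `Z` near `0` the chain rule applies to any choice of it, and so fixes its
  -- value on the velocity.
  have h1 := (hf.mdifferentiableWithinAt (s := twistorSpace Q)).hasMFDerivWithinAt.comp 0
    (hc'.hasMFDerivWithinAt (s := c ⁻¹' twistorSpace Q)) subset_rfl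
  have h2 := hf.hasMFDerivAt.comp 0 hc'
  exact DFunLike.congr_fun (hasMFDerivAt_unique (h1.hasMFDerivAt hcZ) h2) (1 : ℝ)

/-- The normalized trace as a continuous linear map. -/
def normTraceL [FiniteDimensional ℝ E] : (E →L[ℝ] E) →L[ℝ] ℝ :=
  LinearMap.toContinuousLinearMap
    { toFun := normTrace
      map_add' := normTrace_add
      map_smul' := normTrace_smul }

lemma IsAdmissibleBasis.isQuatTriple_coord {p y : M} (hy : y ∈ coordSource E p)
    {Qy : Submodule ℝ (EndT E y)} {J : Fin 3 → EndT E y} (hJ : IsAdmissibleBasis Qy J) :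
    IsQuatTriple (fun i ↦ coord p (⟨y, J i⟩ : EndBundle E M)) where
  sq i := by rw [← coord_comp hy, hJ.sq, coord_neg, coord_id hy]
  mul01 := by rw [← coord_comp hy, hJ.mul_zero_one]
  mul12 := by rw [← coord_comp hy, hJ.mul_one_two]
  mul20 := by rw [← coord_comp hy, hJ.mul_two_zero]

lemma IsAdmissibleBasis.coord_mem_span {p y : M} {Qy : Submodule ℝ (EndT E y)}
    {J : Fin 3 → EndT E y} (hJ : IsAdmissibleBasis Qy J) {T : EndT E y} (hT : T ∈ Qy) :
    coord p (⟨y, T⟩ : EndBundle E M) ∈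
      Submodule.span ℝ (Set.range fun i ↦ coord p (⟨y, J i⟩ : EndBundle E M)) := by
  rw [← hJ.span_eq] at hT
  obtain ⟨u, rfl⟩ := (Submodule.mem_span_range_iff_exists_fun ℝ).1 hT
  rw [coord_sum]
  simp only [coord_smul]
  exact Submodule.sum_mem _ fun i _ ↦ Submodule.smul_mem _ _
    (Submodule.subset_span (Set.mem_range_self i))

lemma coord_sq {Q : Π x : M, Submodule ℝ (EndT E x)} {p : M} {w : EndBundle E M}
    (hw : w ∈ twistorSpace Q) (hp : w.proj ∈ coordSource E p) : coord p w * coord p w = -1 := by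
  have := coord_comp hp w.2 w.2
  rw [hw.2, coord_neg, coord_id hp] at this
  exact this.symm

/-- If `z² = -1` and `W` is tangent to the complex structures at `z`, then `W + [Γ, z]`
anti-commutes with `z`. -/
lemma anticomm_add_commutator {R : Type*} [Ring R] {z W Γ : R} (hz : z * z = -1)
    (hW : W * z + z * W = 0) :
    (W + (Γ * z - z * Γ)) * z = -(z * (W + (Γ * z - z * Γ))) := by
  have h : (W + (Γ * z - z * Γ)) * z + z * (W + (Γ * z - z * Γ)) =
      (W * z + z * W) + (Γ * (z * z) - (z * z) * Γ) := by noncomm_ring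
  rw [hW, hz] at h
  rw [eq_neg_iff_add_eq_zero, h]
  noncomm_ring

variable [FiniteDimensional ℝ E] {Q : Π x : M, Submodule ℝ (EndT E x)}
  {D : CovariantDerivative 𝓘(ℝ, E) E (TangentSpace 𝓘(ℝ, E) : M → Type _)}

/-- The vertical part of a tangent vector of the twistor space belongs to `Θ`. -/
theorem verticalPart_mem_theta (hQ : IsAlmostQuaternionic Q) (hD : IsQuaternionicConnection Q D)
    (hd : Module.finrank ℝ E ≠ 0) {z : EndBundle E M} {U : TangentSpace (endModel E) z}
    (hU : U ∈ twistorTangent Q z) : verticalPart D z U ∈ theta Q z := by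
  obtain ⟨c, hc, hcZ, rfl, rfl⟩ := hU
  set p : M := (c 0).proj with hp
  have hcd := hc.mdifferentiableAt (by simp)
  have hm : MDifferentiableAt 𝓘(ℝ, ℝ) 𝓘(ℝ, E) (fun t ↦ (c t).proj) 0 :=
    ((mdifferentiableAt_totalSpace _ c).1 hcd).1
  have hφ : MDifferentiableAt 𝓘(ℝ, ℝ) 𝓘(ℝ, E →L[ℝ] E) (fun t ↦ coord p (c t)) 0 :=
    ((mdifferentiableAt_totalSpace _ c).1 hcd).2
  have hφd := hasDerivAt_mvfderiv hφ
  set U : TangentSpace (endModel E) (c 0) := mfderiv 𝓘(ℝ, ℝ) (endModel E) c 0 (1 : ℝ) with hU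
  have hprod : toProd U = _ := mfderiv_endBundle (f := c) rfl hcd (1 : ℝ)
  have hz : c 0 ∈ twistorSpace Q := hcZ.self_of_nhds
  have hzz : toEnd (c 0).2 * toEnd (c 0).2 = -1 := hz.2
  have hφ0 : coord p (c 0) = toEnd (c 0).2 := coord_self p (c 0).2
  have hsrc : ∀ᶠ t in 𝓝 (0 : ℝ), (c t).proj ∈ coordSource E p :=
    hm.continuousAt (coordSource_mem_nhds p)
  have hvp := verticalPart_eq D (c 0) U
  rw [hprod] at hvp
  refine ⟨?_, ?_⟩
  · obtain ⟨V, hV, hpV, J, hJs, hJ⟩ := hQ p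
    have hVt : ∀ᶠ t in 𝓝 (0 : ℝ), (c t).proj ∈ V := hm.continuousAt (hV.mem_nhds hpV)
    have hJd (i : Fin 3) : MDifferentiableAt 𝓘(ℝ, E) (endModel E) (secMap (J i)) p :=
      ((hJs i).contMDiffAt (hV.mem_nhds hpV)).mdifferentiableAt (by simp)
    have hg (i : Fin 3) := hasDerivAt_comp_curve (p := p) rfl
      (mdifferentiableAt_secMap_iff.1 (hJd i)) hm
    set X : E := (mfderiv 𝓘(ℝ, ℝ) 𝓘(ℝ, E) (fun t ↦ (c t).proj) 0 (1 : ℝ) : E) with hX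
    -- Coordinates of the curve in the moving admissible basis. Being traces of products of
    -- differentiable functions, they are differentiable.
    set κ : Fin 3 → ℝ → ℝ := fun i t ↦
      normTraceL (coord p (c t) * coord p (secMap (J i) (c t).proj)) with hκ
    have hκd (i : Fin 3) : DifferentiableAt ℝ (κ i) 0 :=
      (normTraceL (E := E)).differentiableAt.comp (0 : ℝ) (hφd.mul (hg i)).differentiableAt
    have heq : (fun t ↦ coord p (c t)) =ᶠ[𝓝 0]
        fun t ↦ ∑ i, κ i t • coord p (secMap (J i) (c t).proj) := by
      filter_upwards [hsrc, hVt, hcZ] with t h1 h2 h3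
      exact ((hJ _ h2).isQuatTriple_coord h1).eq_sum_normTrace hd
        ((hJ _ h2).coord_mem_span h3.1)
    have hsum := HasDerivAt.fun_sum (u := Finset.univ)
      fun i _ ↦ (hκd i).hasDerivAt.smul (hg i)
    have hder := hφd.unique (hsum.congr_of_eventuallyEq heq)
    have h0 : toEnd (c 0).2 = ∑ i, κ i 0 • toEnd (J i p) := by
      rw [← hφ0]
      refine heq.self_of_nhds.trans (Finset.sum_congr rfl fun i _ ↦ ?_)
      exact congrArg (fun T ↦ κ i 0 • T) (coord_self p (J i p))
    -- The product rule for `∑ κ_i J_i`; the commutator with `Γ` completes the derivative of each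
    -- `J_i` to `D_X J_i`, which lies in `Q` because `D` preserves `Q`.
    have hfin : toEnd (verticalPart D (c 0) U) =
        ∑ i, (deriv (κ i) 0 • toEnd (J i p) + κ i 0 • toEnd (endCov D (J i) p X)) := by
      have hvp' : toEnd (verticalPart D (c 0) U) =
          mvfderiv 𝓘(ℝ, ℝ) (fun t ↦ coord p (c t)) 0 (1 : ℝ) +
          (connForm D p X * toEnd (c 0).2 - toEnd (c 0).2 * connForm D p X) := hvp
      have hcJ (i : Fin 3) : coord p (secMap (J i) (c 0).proj) = toEnd (J i p) :=
        coord_self p (J i p)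
      have hE (i : Fin 3) : toEnd (endCov D (J i) p X) = _ := endCov_eq D (hJd i) X
      rw [hvp', hder, h0]
      simp only [hE, hcJ, Fin.sum_univ_three, mul_add, add_mul, smul_mul_assoc, mul_smul_comm]
      module
    have hmem : ∑ i, (deriv (κ i) 0 • J i p + κ i 0 • endCov D (J i) p X) ∈ Q p := by
      refine Submodule.sum_mem _ fun i _ ↦ Submodule.add_mem _ (Submodule.smul_mem _ _ ?_)
        (Submodule.smul_mem _ _ ?_)
      · exact (hJ p hpV).mem i
      · exact hD.preserves V (J i) hV ⟨hJs i, fun x hx ↦ (hJ x hx).mem i⟩ p hpV X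
    exact (hfin ▸ hmem : toEnd (verticalPart D (c 0) U) ∈ Q p)
  -- Differentiating the constant square `-1` along the curve shows that its fibre velocity
  -- anti-commutes with `z`.
  · have hsq : (fun t ↦ coord p (c t) * coord p (c t)) =ᶠ[𝓝 0] fun _ ↦ -1 := by
      filter_upwards [hsrc, hcZ] with t h1 h2
      exact coord_sq h2 h1
    have h := (hφd.mul hφd).unique
      ((hasDerivAt_const (0 : ℝ) (-1 : E →L[ℝ] E)).congr_of_eventuallyEq hsq)
    rw [hφ0] at h
    have := anticomm_add_commutator (Γ := connForm D p (toProd U).1) hzz h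
    rw [hprod, ← hvp] at this
    exact this

end TwistorTangent

/-! ### Vectors with vertical part in `Θ` are velocities of curves in `Z`. -/

section ConverseTangent

/-- A rational curve on the unit sphere with given initial position and velocity. -/
def sphereCurve (u w : Fin 3 → ℝ) (t : ℝ) (i : Fin 3) : ℝ :=
  -- Inverse stereographic projection from `-u` of the line `t ↦ t w / 2` in the plane orthogonal to
  -- `u`. Unlike a trigonometric great circle, it needs no separate case `w = 0`.
  ((1 - t ^ 2 * (∑ j, w j * w j) / 4) * u i + t * w i) / (1 + t ^ 2 * (∑ j, w j * w j) / 4)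

lemma sphereCurve_denom_pos (w : Fin 3 → ℝ) (t : ℝ) : 0 < 1 + t ^ 2 * (∑ j, w j * w j) / 4 := by
  have : 0 ≤ ∑ j, w j * w j := Finset.sum_nonneg fun j _ ↦ mul_self_nonneg _
  positivity

lemma sphereCurve_zero (u w : Fin 3 → ℝ) (i : Fin 3) : sphereCurve u w 0 i = u i := by
  simp [sphereCurve]

lemma sphereCurve_sq {u w : Fin 3 → ℝ} (hu : ∑ i, u i * u i = 1) (huw : ∑ i, u i * w i = 0)
    (t : ℝ) : ∑ i, sphereCurve u w t i * sphereCurve u w t i = 1 := by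
  have h := (sphereCurve_denom_pos w t).ne'
  simp only [sphereCurve, ← mul_div_mul_comm, ← Finset.sum_div]
  rw [div_eq_one_iff_eq (mul_ne_zero h h)]
  simp only [Fin.sum_univ_three] at hu huw ⊢
  set k := w 0 * w 0 + w 1 * w 1 + w 2 * w 2 with hk
  -- With `s = t²|w|²/4` this is `(1 - s)² + 4s = (1 + s)²`, the mixed term vanishing since `u` and
  -- `w` are orthogonal.
  linear_combination (1 - t ^ 2 * k / 4) ^ 2 * hu + 2 * t * (1 - t ^ 2 * k / 4) * huw - t ^ 2 * hk

lemma contDiff_sphereCurve (u w : Fin 3 → ℝ) (i : Fin 3) :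
    ContDiff ℝ ∞ (fun t ↦ sphereCurve u w t i) := by
  unfold sphereCurve
  exact ContDiff.div (by fun_prop) (by fun_prop) fun t ↦ (sphereCurve_denom_pos w t).ne'

lemma hasDerivAt_sphereCurve (u w : Fin 3 → ℝ) (i : Fin 3) :
    HasDerivAt (fun t ↦ sphereCurve u w t i) (w i) 0 := by
  have ha : HasDerivAt (fun t : ℝ ↦ t ^ 2 * (∑ j, w j * w j) / 4) 0 0 := by
    simpa using (((hasDerivAt_id (0 : ℝ)).pow 2).mul_const (∑ j, w j * w j)).div_const 4
  have h1 := ((ha.const_sub 1).mul_const (u i)).add ((hasDerivAt_id (0 : ℝ)).mul_const (w i))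
  have h2 := h1.div (ha.const_add 1) (sphereCurve_denom_pos w 0).ne'
  refine h2.congr_deriv ?_
  simp

variable {E : Type*} [NormedAddCommGroup E] [NormedSpace ℝ E]
  {M : Type*} [TopologicalSpace M] [ChartedSpace E M] [IsManifold 𝓘(ℝ, E) ∞ M]
  [FiniteDimensional ℝ E] {Q : Π x : M, Submodule ℝ (EndT E x)}
  {D : CovariantDerivative 𝓘(ℝ, E) E (TangentSpace 𝓘(ℝ, E) : M → Type _)}

/-- The covariant derivative of a local almost complex structure anti-commutes with it. -/
lemma endCov_anticomm {σ : Π x : M, EndT E x} {p : M}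
    (hσ : MDifferentiableAt 𝓘(ℝ, E) (endModel E) (secMap σ) p)
    (hsq : ∀ᶠ y in 𝓝 p, σ y ∘L σ y = -ContinuousLinearMap.id ℝ (TangentSpace 𝓘(ℝ, E) y))
    (X : TangentSpace 𝓘(ℝ, E) p) :
    toEnd (endCov D σ p X) * toEnd (σ p) = -(toEnd (σ p) * toEnd (endCov D σ p X)) := by
  have hc := mdifferentiableAt_secMap_iff.1 hσ
  have h1 : (fun y ↦ coord p (secMap σ y) * coord p (secMap σ y)) =ᶠ[𝓝 p] fun _ ↦ -1 := by
    filter_upwards [hsq, eventually_mem_coordSource (E := E) p] with y h2 h3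
    have := coord_comp h3 (σ y) (σ y)
    rw [h2, coord_neg, coord_id h3] at this
    exact this.symm
  have h2 := mvfderiv_mul_ring hc hc X
  rw [mvfderiv_congr h1, mvfderiv_const] at h2
  have h3 : coord p (secMap σ p) = toEnd (σ p) := coord_self p (σ p)
  have h4 : toEnd (σ p) * toEnd (σ p) = -1 := hsq.self_of_nhds
  rw [h3] at h2
  rw [endCov_eq D hσ]
  exact anticomm_add_commutator h4 ((add_comm _ _).trans h2.symm)

omit [FiniteDimensional ℝ E] in
lemma contMDiffAt_coord_secMap {A : Π x : M, EndT E x} {p : M}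
    (hA : ContMDiffAt 𝓘(ℝ, E) (endModel E) ∞ (secMap A) p) :
    ContMDiffAt 𝓘(ℝ, E) 𝓘(ℝ, E →L[ℝ] E) ∞ (fun y ↦ coord p (secMap A y)) p :=
  (contMDiffAt_section p).1 hA

/-- Vectors with vertical part in `Θ` are tangent to the twistor space. -/
theorem mem_twistorTangent (hQ : IsAlmostQuaternionic Q) (hD : IsQuaternionicConnection Q D)
    (hd : Module.finrank ℝ E ≠ 0) {z : EndBundle E M} (hz : z ∈ twistorSpace Q)
    {U : TangentSpace (endModel E) z} (hU : verticalPart D z U ∈ theta Q z) :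
    U ∈ twistorTangent Q z := by
  have hE : Nontrivial E := Module.nontrivial_of_finrank_pos (Nat.pos_of_ne_zero hd)
  obtain ⟨p, z⟩ := z
  obtain ⟨V, hV, hpV, J, hJs, hJ⟩ := hQ p
  have hJp := hJ p hpV
  have hT : IsQuatTriple fun i ↦ toEnd (J i p) := hJp.isQuatTriple
  have hJc (i : Fin 3) : ContMDiffAt 𝓘(ℝ, E) (endModel E) ∞ (secMap (J i)) p :=
    (hJs i).contMDiffAt (hV.mem_nhds hpV)
  have hJd (i : Fin 3) : MDifferentiableAt 𝓘(ℝ, E) (endModel E) (secMap (J i)) p :=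
    (hJc i).mdifferentiableAt (by simp)
  have hzQ : z ∈ Q p := hz.1
  have hzz : z ∘L z = -ContinuousLinearMap.id ℝ (TangentSpace 𝓘(ℝ, E) p) := hz.2
  set u : Fin 3 → ℝ := fun i ↦ metricQ z (J i p) with hu
  have hzu : z = ∑ i, u i • J i p := hJp.eq_sum_metricQ hd hzQ
  have hzu' : toEnd z = ∑ i, u i • toEnd (J i p) := hzu
  have hu1 : ∑ i, u i * u i = 1 := hT.sum_sq_eq_one (by rw [← hzu']; exact hzz)
  -- the local section `σ` of the twistor space through `z`
  set σ : Π x : M, EndT E x := fun x ↦ ∑ i, u i • J i x with hσ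
  have hσp : σ p = z := hzu.symm
  have hσs : ContMDiffOn 𝓘(ℝ, E) (endModel E) ∞ (secMap σ) V :=
    ContMDiffOn.sum_section fun i _ ↦ ContMDiffOn.const_smul_section (a := u i) (hJs i)
  have hσQ : ∀ x ∈ V, σ x ∈ Q x := fun x hx ↦
    Submodule.sum_mem _ fun i _ ↦ Submodule.smul_mem _ _ ((hJ x hx).mem i)
  have hσd : MDifferentiableAt 𝓘(ℝ, E) (endModel E) (secMap σ) p :=
    (hσs.contMDiffAt (hV.mem_nhds hpV)).mdifferentiableAt (by simp)
  have hcomb {x : M} (hx : x ∈ V) {v : Fin 3 → ℝ} (hv : ∑ i, v i * v i = 1) :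
      (∑ i, v i • J i x) ∘L (∑ i, v i • J i x) =
        -ContinuousLinearMap.id ℝ (TangentSpace 𝓘(ℝ, E) x) := by
    have h := (hJ x hx).isQuatTriple.sq_combination v
    rw [hv, neg_one_smul] at h
    exact h
  set X : E := (toProd U).1 with hX
  have hCQ : endCov D σ p X ∈ Q p := hD.preserves V σ hV ⟨hσs, hσQ⟩ p hpV X
  have hCa := endCov_anticomm (D := D) hσd
    ((hV.eventually_mem hpV).mono fun y hy ↦ hcomb hy hu1) X
  rw [hσp] at hCa
  set B : EndT E p := verticalPart D ⟨p, z⟩ U with hB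
  have hBQ : B ∈ Q p := hU.1
  have hBa : toEnd B * toEnd z = -(toEnd z * toEnd B) := hU.2
  -- The section `σ` has constant coefficients `u`, so moving along it already produces the vertical
  -- part `D_X σ`. The coefficients must supply the difference `B - D_X σ`, which anti-commutes with
  -- `z`; this makes `w` orthogonal to `u`, hence tangent to the sphere at `u`.
  set w : Fin 3 → ℝ := fun i ↦ metricQ (B - endCov D σ p X) (J i p) with hw
  have hBw : B - endCov D σ p X = ∑ i, w i • J i p :=
    hJp.eq_sum_metricQ hd (Submodule.sub_mem _ hBQ hCQ)
  have hBw' : toEnd B - toEnd (endCov D σ p X) = ∑ i, w i • toEnd (J i p) := hBw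
  have huw : ∑ i, u i * w i = 0 := by
    have h := hT.anticomm_combination u w
    rw [← hzu', ← hBw', mul_sub, sub_mul, hBa, hCa] at h
    have h1 : (-2 * ∑ i, u i * w i) • (1 : E →L[ℝ] E) = 0 := by
      rw [← h]; abel
    rcases smul_eq_zero.1 h1 with h2 | h2
    · linarith
    · exact absurd h2 one_ne_zero
  obtain ⟨m, hm0, hms, hmX⟩ := exists_curve p X
  have hmd := hms.mdifferentiableAt (by simp)
  set c : ℝ → EndBundle E M := fun t ↦ ⟨m t, ∑ i, sphereCurve u w t i • J i (m t)⟩ with hc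
  have hc0 : c 0 = ⟨p, z⟩ := by
    have h1 : c 0 = ⟨m 0, σ (m 0)⟩ := by simp only [hc, sphereCurve_zero, hσ]
    rw [h1, hm0, hσp]
  have hcoord : (fun t ↦ coord p (c t)) =
      fun t ↦ ∑ i, sphereCurve u w t i • coord p (secMap (J i) (m t)) := by
    funext t
    simp only [hc, coord_sum, coord_smul]
    rfl
  have hcs : ContMDiffAt 𝓘(ℝ, ℝ) (endModel E) ∞ c 0 := by
    rw [contMDiffAt_totalSpace, hc0]
    refine ⟨hms, ?_⟩
    change ContMDiffAt 𝓘(ℝ, ℝ) 𝓘(ℝ, E →L[ℝ] E) ∞ (fun t ↦ coord p (c t)) 0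
    rw [hcoord]
    refine ContMDiffAt.sum fun i _ ↦ ?_
    refine ((contDiff_sphereCurve u w i).contMDiff.contMDiffAt).smul ?_
    have h1 : ContMDiffAt 𝓘(ℝ, E) 𝓘(ℝ, E →L[ℝ] E) ∞ (fun y ↦ coord p (secMap (J i) y)) (m 0) := by
      rw [hm0]; exact contMDiffAt_coord_secMap (hJc i)
    exact h1.comp 0 hms
  have hmV : ∀ᶠ t in 𝓝 (0 : ℝ), m t ∈ V := by
    refine hmd.continuousAt ?_
    rw [hm0]; exact hV.mem_nhds hpV
  refine ⟨c, hcs, ?_, hc0, ?_⟩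
  · filter_upwards [hmV] with t ht
    have hmem : ∑ i, sphereCurve u w t i • J i (m t) ∈ Q (m t) :=
      Submodule.sum_mem _ fun i _ ↦ Submodule.smul_mem _ _ ((hJ _ ht).mem i)
    exact ⟨hmem, hcomb ht (sphereCurve_sq hu1 huw t)⟩
  · refine (mfderiv_endBundle hc0 (hcs.mdifferentiableAt (by simp)) (1 : ℝ)).trans ?_
    refine Prod.ext hmX ?_
    have hg (i : Fin 3) := hasDerivAt_comp_curve hm0 (mdifferentiableAt_secMap_iff.1 (hJd i)) hmd
    rw [hmX] at hg
    have hsum := HasDerivAt.fun_sum (u := Finset.univ)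
      fun i _ ↦ (hasDerivAt_sphereCurve u w i).smul (hg i)
    have h1 : mvfderiv 𝓘(ℝ, ℝ) (fun t ↦ coord p (c t)) 0 (1 : ℝ) = _ :=
      (congrArg (fun f ↦ mvfderiv 𝓘(ℝ, ℝ) f 0 (1 : ℝ)) hcoord).trans (mvfderiv_one_eq hsum)
    refine h1.trans ?_
    have hvp : toEnd B = (toProd U).2 + (connForm D p X * toEnd z - toEnd z * connForm D p X) :=
      verticalPart_eq D ⟨p, z⟩ U
    have hcJ (i : Fin 3) : coord p (secMap (J i) (m 0)) = toEnd (J i p) := by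
      rw [hm0]; exact coord_self p (J i p)
    have hσe : toEnd (endCov D σ p X) = _ := endCov_eq D hσd X
    have hdσ : mvfderiv 𝓘(ℝ, E) (fun y ↦ coord p (secMap σ y)) p X =
        ∑ i, u i • mvfderiv 𝓘(ℝ, E) (fun y ↦ coord p (secMap (J i) y)) p X := by
      have h2 := hasDerivAt_comp_curve hm0 (mdifferentiableAt_secMap_iff.1 hσd) hmd
      rw [hmX] at h2
      refine h2.unique ?_
      have h3 : (fun s ↦ coord p (secMap σ (m s))) =
          fun s ↦ ∑ i, u i • coord p (secMap (J i) (m s)) := by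
        funext s
        simp only [secMap, hσ, coord_sum, coord_smul]
      rw [h3]
      exact HasDerivAt.fun_sum fun i _ ↦ (hg i).const_smul (u i)
    rw [hσp, hdσ] at hσe
    -- The fibre velocity is `∑ w_i J_i + dσ(X) = B - D_X σ + dσ(X) = B - [Γ(X), z]`, the fibre
    -- component of `U`.
    simp only [sphereCurve_zero, hcJ, Finset.sum_add_distrib]
    rw [← hBw', hσe, hvp]
    change _ = (toProd U).2
    abel

end ConverseTangent

/-! ### Computation of `∂̄ Ã`. -/

section Holomorphic

variable {E : Type*} [NormedAddCommGroup E] [NormedSpace ℝ E]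
  {M : Type*} [TopologicalSpace M] [ChartedSpace E M] [IsManifold 𝓘(ℝ, E) ∞ M]
  {Q : Π x : M, Submodule ℝ (EndT E x)}

lemma exists_isAdmissibleBasis (hQ : IsAlmostQuaternionic Q) (p : M) :
    ∃ J : Fin 3 → EndT E p, IsAdmissibleBasis (Q p) J := by
  obtain ⟨V, -, hpV, J, -, hJ⟩ := hQ p
  exact ⟨_, hJ p hpV⟩

/-- For `B` orthogonal to `z` the scalar part of `zB` vanishes, so `zB` is a cross product and
remains in `Q`. -/
lemma theta_comp_mem (hQ : IsAlmostQuaternionic Q) (hd : Module.finrank ℝ E ≠ 0)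
    {z : EndBundle E M} (hz : z ∈ twistorSpace Q) {B : EndT E z.proj} (hB : B ∈ theta Q z) :
    z.2 ∘L B ∈ theta Q z := by
  have hE : Nontrivial E := Module.nontrivial_of_finrank_pos (Nat.pos_of_ne_zero hd)
  obtain ⟨J, hJ⟩ := exists_isAdmissibleBasis hQ z.proj
  have hT : IsQuatTriple fun i ↦ toEnd (J i) := hJ.isQuatTriple
  have hBa : toEnd B * toEnd z.2 = -(toEnd z.2 * toEnd B) := hB.2
  refine ⟨?_, ?_⟩
  · set u : Fin 3 → ℝ := fun i ↦ metricQ z.2 (J i)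
    set w : Fin 3 → ℝ := fun i ↦ metricQ B (J i)
    have hzu : toEnd z.2 = ∑ i, u i • toEnd (J i) := hJ.eq_sum_metricQ hd hz.1
    have hBw : toEnd B = ∑ i, w i • toEnd (J i) := hJ.eq_sum_metricQ hd hB.1
    have huw : ∑ i, u i * w i = 0 := by
      have h := hT.anticomm_combination u w
      rw [← hzu, ← hBw, hBa, add_neg_cancel] at h
      rcases smul_eq_zero.1 h.symm with h2 | h2
      · linarith
      · exact absurd h2 one_ne_zero
    have h : toEnd z.2 * toEnd B = (u 1 * w 2 - u 2 * w 1) • toEnd (J 0) +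
        (u 2 * w 0 - u 0 * w 2) • toEnd (J 1) + (u 0 * w 1 - u 1 * w 0) • toEnd (J 2) := by
      rw [hzu, hBw, hT.mul_combination u w, huw, neg_zero, zero_smul, zero_add]
    have hmem : (u 1 * w 2 - u 2 * w 1) • J 0 + (u 2 * w 0 - u 0 * w 2) • J 1 +
        (u 0 * w 1 - u 1 * w 0) • J 2 ∈ Q z.proj :=
      Submodule.add_mem _ (Submodule.add_mem _ (Submodule.smul_mem _ _ (hJ.mem 0))
        (Submodule.smul_mem _ _ (hJ.mem 1))) (Submodule.smul_mem _ _ (hJ.mem 2))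
    exact (h ▸ hmem : toEnd z.2 * toEnd B ∈ Q z.proj)
  · have h : toEnd z.2 * toEnd B * toEnd z.2 = -(toEnd z.2 * (toEnd z.2 * toEnd B)) := by
      rw [mul_assoc, hBa, mul_neg]
    exact h

/-- The anti-commutator of `z` and `A` is scalar, so `zAz` is `A` plus a multiple of `z`, an element
of `Q`. Anti-commutation with `z` only uses `z² = -1`. -/
lemma distinguishedSection_mem_theta (hQ : IsAlmostQuaternionic Q)
    (hd : Module.finrank ℝ E ≠ 0) {A : Π x : M, EndT E x} (hA : ∀ x, A x ∈ Q x)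
    {z : EndBundle E M} (hz : z ∈ twistorSpace Q) : distinguishedSection A z ∈ theta Q z := by
  obtain ⟨J, hJ⟩ := exists_isAdmissibleBasis hQ z.proj
  have hT : IsQuatTriple fun i ↦ toEnd (J i) := hJ.isQuatTriple
  have hzz : toEnd z.2 * toEnd z.2 = -1 := hz.2
  refine ⟨Submodule.smul_mem _ _ (Submodule.add_mem _ (hA _) ?_), ?_⟩
  · set u : Fin 3 → ℝ := fun i ↦ metricQ z.2 (J i)
    set a : Fin 3 → ℝ := fun i ↦ metricQ (A z.proj) (J i)
    have hzu : toEnd z.2 = ∑ i, u i • toEnd (J i) := hJ.eq_sum_metricQ hd hz.1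
    have hAa : toEnd (A z.proj) = ∑ i, a i • toEnd (J i) := hJ.eq_sum_metricQ hd (hA z.proj)
    have h := hT.anticomm_combination u a
    rw [← hzu, ← hAa] at h
    have h1 : toEnd z.2 * (toEnd (A z.proj) * toEnd z.2) =
        (-2 * ∑ i, u i * a i) • toEnd z.2 + toEnd (A z.proj) := by
      rw [← eq_sub_iff_add_eq'] at h
      rw [h, mul_sub, ← mul_assoc, hzz, mul_smul_comm, mul_one, neg_one_mul, sub_neg_eq_add]
    have hmem : (-2 * ∑ i, u i * a i) • z.2 + A z.proj ∈ Q z.proj :=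
      Submodule.add_mem _ (Submodule.smul_mem _ _ hz.1) (hA _)
    exact (h1 ▸ hmem : toEnd z.2 * (toEnd (A z.proj) * toEnd z.2) ∈ Q z.proj)
  · have h (z a : E →L[ℝ] E) (hz : z * z = -1) : ((2⁻¹ : ℝ) • (a + z * (a * z))) * z =
        -(z * ((2⁻¹ : ℝ) • (a + z * (a * z)))) := by
      rw [smul_mul_assoc, mul_smul_comm, ← smul_neg]
      congr 1
      have h1 : z * (a * z) * z = -(z * a) := by
        rw [mul_assoc, mul_assoc, hz, mul_neg_one, mul_neg]
      have h2 : z * (z * (a * z)) = -(a * z) := by rw [← mul_assoc, hz, neg_one_mul]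
      rw [add_mul, mul_add, h1, h2]
      abel
    exact h _ _ hzz

/-- The distinguished section in coordinates. -/
lemma coord_distinguishedSection {p : M} {w : EndBundle E M} (hw : w.proj ∈ coordSource E p)
    (A : Π x : M, EndT E x) :
    coord p ⟨w.proj, distinguishedSection A w⟩ = (2⁻¹ : ℝ) • (coord p (secMap A w.proj) +
      coord p w * (coord p (secMap A w.proj) * coord p w)) := by
  rw [distinguishedSection, thetaProj, coord_smul, coord_add, coord_comp hw, coord_comp hw]
  rfl

lemma coord_distinguishedSection_eventuallyEq (A : Π x : M, EndT E x) (z : EndBundle E M) :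
    (fun w ↦ coord z.proj ⟨w.proj, distinguishedSection A w⟩) =ᶠ[𝓝 z]
      fun w ↦ (2⁻¹ : ℝ) • (coord z.proj (secMap A w.proj) +
        coord z.proj w * (coord z.proj (secMap A w.proj) * coord z.proj w)) := by
  have h : ∀ᶠ w : EndBundle E M in 𝓝 z, w.proj ∈ coordSource E z.proj :=
    (FiberBundle.continuous_proj (E →L[ℝ] E) (EndT E : M → Type _)).continuousAt
      (coordSource_mem_nhds z.proj)
  filter_upwards [h] with w hw
  exact coord_distinguishedSection hw A

lemma contMDiffAt_coord_distinguishedSection {A : Π x : M, EndT E x} {z : EndBundle E M}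
    (hA : ContMDiffAt 𝓘(ℝ, E) (endModel E) ∞ (secMap A) z.proj) :
    ContMDiffAt (endModel E) 𝓘(ℝ, E →L[ℝ] E) ∞
      (fun w ↦ coord z.proj ⟨w.proj, distinguishedSection A w⟩) z := by
  refine ContMDiffAt.congr_of_eventuallyEq ?_ (coord_distinguishedSection_eventuallyEq A z)
  have h1 : ContMDiffAt (endModel E) 𝓘(ℝ, E →L[ℝ] E) ∞
      (fun w : EndBundle E M ↦ coord z.proj (secMap A w.proj)) z :=
    (contMDiffAt_coord_secMap hA).comp z (contMDiffAt_proj (EndT E : M → Type _))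
  have h2 := contMDiffAt_coord z
  exact (contMDiffAt_const (c := (2⁻¹ : ℝ)) (I' := 𝓘(ℝ, ℝ))).smul
    (h1.add (h2.clm_comp (h1.clm_comp h2)))

lemma contMDiff_distinguishedSection {A : Π x : M, EndT E x}
    (hA : ContMDiff 𝓘(ℝ, E) (endModel E) ∞ (secMap A)) :
    ContMDiff (endModel E) (endModel E) ∞
      (fun z : EndBundle E M ↦ (⟨z.proj, distinguishedSection A z⟩ : EndBundle E M)) := by
  intro z
  rw [contMDiffAt_totalSpace]
  exact ⟨contMDiffAt_proj (EndT E : M → Type _), contMDiffAt_coord_distinguishedSection (hA z.proj)⟩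

variable [FiniteDimensional ℝ E]
  {D : CovariantDerivative 𝓘(ℝ, E) E (TangentSpace 𝓘(ℝ, E) : M → Type _)}

/-- The derivative of the distinguished section with respect to the connection `π^*D`. -/
lemma pullbackCov_distinguishedSection {A : Π x : M, EndT E x} {z : EndBundle E M}
    (hA : ContMDiffAt 𝓘(ℝ, E) (endModel E) ∞ (secMap A) z.proj)
    {U : TangentSpace (endModel E) z} (hU : U ∈ twistorTangent Q z) :
    toEnd (pullbackCov D (twistorSpace Q) (distinguishedSection A) z U) = (2⁻¹ : ℝ) •
      (toEnd (endCov D A z.proj (toProd U).1) +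
        toEnd (verticalPart D z U) * (toEnd (A z.proj) * toEnd z.2) +
        toEnd z.2 * (toEnd (endCov D A z.proj (toProd U).1) * toEnd z.2) +
        toEnd z.2 * (toEnd (A z.proj) * toEnd (verticalPart D z U))) := by
  have hAd := hA.mdifferentiableAt (by simp)
  have hc := mdifferentiableAt_coord z
  have ha : MDifferentiableAt (endModel E) 𝓘(ℝ, E →L[ℝ] E)
      (fun w : EndBundle E M ↦ coord z.proj (secMap A w.proj)) z :=
    (mdifferentiableAt_secMap_iff.1 hAd).comp z (mdifferentiableAt_proj (EndT E : M → Type _))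
  have hac : MDifferentiableAt (endModel E) 𝓘(ℝ, E →L[ℝ] E)
      (fun w : EndBundle E M ↦ coord z.proj (secMap A w.proj) * coord z.proj w) z :=
    (ha.hasMFDerivAt.mul' hc.hasMFDerivAt).mdifferentiableAt
  have hcac : MDifferentiableAt (endModel E) 𝓘(ℝ, E →L[ℝ] E) (fun w : EndBundle E M ↦
      coord z.proj w * (coord z.proj (secMap A w.proj) * coord z.proj w)) z :=
    (hc.hasMFDerivAt.mul' hac.hasMFDerivAt).mdifferentiableAt
  have hda : mvfderiv (endModel E) (fun w : EndBundle E M ↦ coord z.proj (secMap A w.proj)) z U =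
      mvfderiv 𝓘(ℝ, E) (fun y ↦ coord z.proj (secMap A y)) z.proj (toProd U).1 := by
    refine (DFunLike.congr_fun (mfderiv_comp z (mdifferentiableAt_secMap_iff.1 hAd)
      (mdifferentiableAt_proj (EndT E : M → Type _))) U).trans ?_
    exact congrArg (mvfderiv 𝓘(ℝ, E) (fun y ↦ coord z.proj (secMap A y)) z.proj)
      (projDeriv_eq z U)
  have hcz : coord z.proj z = toEnd z.2 := coord_self z.proj z.2
  have haz : coord z.proj (secMap A z.proj) = toEnd (A z.proj) := coord_self z.proj (A z.proj)
  have hdc : mvfderiv (endModel E) (coord z.proj) z U = (toProd U).2 := mvfderiv_coord z U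
  have hsum : mvfderiv (endModel E) (fun w : EndBundle E M ↦ coord z.proj (secMap A w.proj) +
      coord z.proj w * (coord z.proj (secMap A w.proj) * coord z.proj w)) z U = _ :=
    DFunLike.congr_fun (mvfderiv_add ha hcac) U
  have hder := mvfderiv_clm_comp ((2⁻¹ : ℝ) • ContinuousLinearMap.id ℝ (E →L[ℝ] E))
    (ha.add hcac) U
  have hγ : toEnd (endCov D A z.proj (toProd U).1) = _ := endCov_eq D hAd (toProd U).1
  have hds : toEnd (distinguishedSection A z) =
    (2⁻¹ : ℝ) • (toEnd (A z.proj) + toEnd z.2 * (toEnd (A z.proj) * toEnd z.2)) := rfl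
  rw [pullbackCov_eq, mvfderivWithin_twistorSpace
    ((contMDiffAt_coord_distinguishedSection hA).mdifferentiableAt (by simp)) hU,
    mvfderiv_congr (coord_distinguishedSection_eventuallyEq A z)]
  refine (congrArg (fun T : E →L[ℝ] E ↦ T + _) (hder.trans (congrArg (fun T : E →L[ℝ] E ↦
    (2⁻¹ : ℝ) • T) hsum))).trans ?_
  rw [verticalPart_eq, hγ, hds, ← hda, ← hdc]
  have h1 := mvfderiv_mul_ring hc hac U
  have h2 := mvfderiv_mul_ring ha hc U
  rw [h2, hcz, haz] at h1
  change (2⁻¹ : ℝ) • (mvfderiv (endModel E)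
    (fun w : EndBundle E M ↦ coord z.proj (secMap A w.proj)) z U +
    mvfderiv (endModel E) (fun w : EndBundle E M ↦
      coord z.proj w * (coord z.proj (secMap A w.proj) * coord z.proj w)) z U) + _ = _
  rw [h1, mul_smul_comm, smul_mul_assoc, ← smul_sub, ← smul_add]
  congr 1
  -- What remains is a ring identity: `[Γ, ·]` satisfies the Leibniz rule, so the commutator with `A
  -- + zAz` distributes over the factors and completes `dA` to `DA` and `dz` to the vertical part.
  generalize mvfderiv (endModel E) (fun w : EndBundle E M ↦
    coord z.proj (secMap A w.proj)) z U = a'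
  generalize mvfderiv (endModel E) (coord z.proj) z U = c'
  generalize connForm D z.proj (toProd U).1 = Γ
  generalize toEnd (A z.proj) = a
  generalize toEnd z.2 = c
  change E →L[ℝ] E at a'
  change E →L[ℝ] E at c'
  noncomm_ring

omit [FiniteDimensional ℝ E] in
lemma toProd_fst_eq (z : EndBundle E M) (U : TangentSpace (endModel E) z) :
    (toProd U).1 = toModel (projDeriv z U) := (projDeriv_eq z U).symm

/-- The operator `∂̄` evaluates `∇` at `𝒥U`, where the derivative within `Z` is controlled only if
`𝒥U` is again tangent to `Z`. -/
lemma twistorJ_mem_twistorTangent (hQ : IsAlmostQuaternionic Q)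
    (hD : IsQuaternionicConnection Q D) (hd : Module.finrank ℝ E ≠ 0) {z : EndBundle E M}
    (hz : z ∈ twistorSpace Q) {U : TangentSpace (endModel E) z} (hU : U ∈ twistorTangent Q z) :
    twistorJ D z U ∈ twistorTangent Q z := by
  refine mem_twistorTangent hQ hD hd hz ?_
  have h : verticalPart D z (twistorJ D z U) = z.2 ∘L verticalPart D z U :=
    verticalPart_twistorJ D z U
  rw [h]
  exact theta_comp_mem hQ hd hz (verticalPart_mem_theta hQ hD hd hU)

lemma horizontalLift_mem_twistorTangent (hQ : IsAlmostQuaternionic Q)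
    (hD : IsQuaternionicConnection Q D) (hd : Module.finrank ℝ E ≠ 0) {z : EndBundle E M}
    (hz : z ∈ twistorSpace Q) (X : TangentSpace 𝓘(ℝ, E) z.proj) :
    horizontalLift D z X ∈ twistorTangent Q z := by
  refine mem_twistorTangent hQ hD hd hz ?_
  have h : verticalPart D z (horizontalLift D z X) = 0 := by
    refine (verticalPart_eq D z (horizontalLift D z X)).trans ?_
    rw [horizontalLift_eq]
    exact neg_add_cancel _
  rw [h]
  refine ⟨Submodule.zero_mem _, ?_⟩
  simp

/-- The `(0,1)`-derivative of the distinguished section only depends on the covariant derivative of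
the given section of `Q`. -/
theorem dbar_distinguishedSection (hQ : IsAlmostQuaternionic Q)
    (hD : IsQuaternionicConnection Q D) (hd : Module.finrank ℝ E ≠ 0) {A : Π x : M, EndT E x}
    {z : EndBundle E M} (hA : ContMDiffAt 𝓘(ℝ, E) (endModel E) ∞ (secMap A) z.proj)
    (hz : z ∈ twistorSpace Q) {U : TangentSpace (endModel E) z} (hU : U ∈ twistorTangent Q z) :
    dbar Q D (distinguishedSection A) z U = (2⁻¹ : ℝ) •
      (thetaProj z (endCov D A z.proj (projDeriv z U)) +
        z.2 ∘L thetaProj z (endCov D A z.proj (z.2 (projDeriv z U)))) := by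
  have hzz : toEnd z.2 * toEnd z.2 = -1 := hz.2
  have hB : toEnd (verticalPart D z U) * toEnd z.2 = -(toEnd z.2 * toEnd (verticalPart D z U)) :=
    (verticalPart_mem_theta hQ hD hd hU).2
  have h1 := pullbackCov_distinguishedSection (D := D) hA hU
  have h2 := pullbackCov_distinguishedSection (D := D) hA
    (twistorJ_mem_twistorTangent hQ hD hd hz hU)
  rw [verticalPart_twistorJ, twistorJ_fst] at h2
  have h3 := vertical_cancel (A := toEnd (A z.proj))
    (G := toEnd (endCov D A z.proj (toProd U).1))
    (G' := toEnd (endCov D A z.proj (toEnd z.2 (toProd U).1))) hzz hB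
  -- The three halves come from `∂̄`, from the projection in `∇` and from the projection in `Ã`. The
  -- factor 2 of `vertical_cancel` absorbs one of them, which reflects `Π² = Π`.
  have h4 (c P P' : E →L[ℝ] E) : (2⁻¹ : ℝ) • ((2⁻¹ : ℝ) • ((2⁻¹ : ℝ) • P +
      c * ((2⁻¹ : ℝ) • P * c)) + c * ((2⁻¹ : ℝ) • ((2⁻¹ : ℝ) • P' + c * ((2⁻¹ : ℝ) • P' * c)))) =
      (2⁻¹ * (2⁻¹ * 2⁻¹) : ℝ) • ((P + c * (P * c)) + c * (P' + c * (P' * c))) := by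
    simp only [smul_mul_assoc, mul_smul_comm, ← smul_add, smul_smul]
  have h5 : toEnd (dbar Q D (distinguishedSection A) z U) = (2⁻¹ : ℝ) • ((2⁻¹ : ℝ) •
      (toEnd (pullbackCov D (twistorSpace Q) (distinguishedSection A) z U) + toEnd z.2 *
        (toEnd (pullbackCov D (twistorSpace Q) (distinguishedSection A) z U) * toEnd z.2)) +
      toEnd z.2 * ((2⁻¹ : ℝ) • (toEnd (pullbackCov D (twistorSpace Q) (distinguishedSection A) z
        (twistorJ D z U)) + toEnd z.2 * (toEnd (pullbackCov D (twistorSpace Q)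
          (distinguishedSection A) z (twistorJ D z U)) * toEnd z.2)))) := rfl
  rw [h1, h2, h4, h3] at h5
  have h6 (c G G' : E →L[ℝ] E) : (2⁻¹ * (2⁻¹ * 2⁻¹) : ℝ) •
      (2 * (G + c * (G * c) + c * (G' + c * (G' * c)))) =
      (2⁻¹ : ℝ) • ((2⁻¹ : ℝ) • (G + c * (G * c)) + c * ((2⁻¹ : ℝ) • (G' + c * (G' * c)))) := by
    rw [mul_smul_comm, ← smul_add, two_mul]
    module
  rw [h6, toProd_fst_eq] at h5
  exact h5

/-- Smoothness and values in `Θ` are automatic for `Ã`. Horizontal lifts are tangent to `Z` and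
realize every `X`, so no tangent vector of `Z` remains in the condition. -/
theorem isHolomorphicSection_iff (hQ : IsAlmostQuaternionic Q)
    (hD : IsQuaternionicConnection Q D) (hd : Module.finrank ℝ E ≠ 0) {A : Π x : M, EndT E x}
    (hA : IsSmoothSectionOn Q A Set.univ) :
    IsHolomorphicSection Q D (distinguishedSection A) ↔ ∀ z ∈ twistorSpace Q,
      ∀ X, thetaProj z (endCov D A z.proj X) + z.2 ∘L thetaProj z (endCov D A z.proj (z.2 X)) =
        0 := by
  have hAs : ContMDiff 𝓘(ℝ, E) (endModel E) ∞ (secMap A) := contMDiffOn_univ.1 hA.1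
  refine ⟨fun h z hz X ↦ ?_, fun h ↦ ⟨fun z hz ↦ ?_, ?_, fun z hz U hU ↦ ?_⟩⟩
  · have hX := horizontalLift_mem_twistorTangent (D := D) hQ hD hd hz X
    have h1 := h.dbar_eq_zero z hz _ hX
    have h2 : projDeriv z (horizontalLift D z X) = X := by
      refine (projDeriv_eq z _).trans ?_
      exact congrArg Prod.fst (horizontalLift_eq D z X)
    rw [dbar_distinguishedSection hQ hD hd (hAs _) hz hX, h2] at h1
    exact (smul_eq_zero.1 h1).resolve_left (by norm_num)
  · exact distinguishedSection_mem_theta hQ hd (fun x ↦ hA.2 x (mem_univ x)) hz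
  · exact (contMDiff_distinguishedSection hAs).contMDiffOn
  · rw [dbar_distinguishedSection hQ hD hd (hAs _) hz hU, h z hz, smul_zero]

end Holomorphic

end QuatTwistor

end

theorem proposition4p1 {n : ℕ} (hn : 2 ≤ n)
    {E : Type*} [NormedAddCommGroup E] [NormedSpace ℝ E] [FiniteDimensional ℝ E]
    (hE : Module.finrank ℝ E = 4 * n)
    {M : Type*} [TopologicalSpace M] [T2Space M] [SecondCountableTopology M] [ConnectedSpace M]
    [ChartedSpace E M] [IsManifold 𝓘(ℝ, E) ∞ M]
    (Q : Π x : M, Submodule ℝ (EndT E x)) (hQ : IsAlmostQuaternionic Q)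
    (D : CovariantDerivative 𝓘(ℝ, E) E (TangentSpace 𝓘(ℝ, E) : M → Type _))
    (hD : IsQuaternionicConnection Q D) (hsd : IsSelfDual Q D)
    (A : Π x : M, EndT E x) (hA : IsSmoothSectionOn Q A Set.univ) :
    IsHolomorphicSection Q D (distinguishedSection A) ↔ IsPenroseSolution Q D A := by
  have hd : Module.finrank ℝ E ≠ 0 := by omega
  have hγ (x : M) (X : TangentSpace 𝓘(ℝ, E) x) : endCov D A x X ∈ Q x :=
    hD.preserves univ A isOpen_univ hA x (mem_univ x) X
  rw [isHolomorphicSection_iff hQ hD hd hA]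
  refine ⟨fun h x J hJ ↦ ?_, fun h z hz ↦ ?_⟩
  · refine (penroseProj_eq_zero_iff hJ _).2
      ((forall_thetaProj_add_eq_zero_iff hJ hd _ (hγ x)).1 fun z hz hzz ↦ ?_)
    exact h ⟨x, z⟩ ⟨hz, hzz⟩
  -- The Penrose equation in a single admissible basis at `π(z)` already gives the `∂̄` equation at
  -- every point of the fibre.
  · obtain ⟨J, hJ⟩ := exists_isAdmissibleBasis hQ z.proj
    exact (forall_thetaProj_add_eq_zero_iff hJ hd _ (hγ z.proj)).2
      ((penroseProj_eq_zero_iff hJ _).1 (h z.proj J hJ)) z.2 hz.1 hz.2
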